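/- **Setting.** For $n\ge 1$ qubits and $\mathbf a\in\{0,1,2,3\}^n$ let $P_{\mathbf a}=P_{a_1}\otimes\cdots\otimes P_{a_n}$ be the Pauli strings ($P_0=1$, $P_1=X$, $P_2=Y$, $P_3=Z$), and let $|\Phi_{\mathbf a}\rangle=(1\otimes P_{\mathbf a})\,2^{-n/2}\sum_{z\in\{0,1\}^n}|z\rangle\otimes|z\rangle$ be the Bell states. A state is a density matrix $\rho$ (positive semidefinite, trace one); its Bell distribution is $q_\rho(\mathbf a)=\langle\Phi_{\mathbf a}|\rho\otimes\rho|\Phi_{\mathbf a}\rangle$. Put $$c(\rho,\sigma)=\frac{\operatorname{tr}(\rho\sigma)}{\sqrt{\operatorname{tr}\rho^2\,\operatorname{tr}\sigma^2}},\qquad \|X\|_{\mathrm{tr}}=\operatorname{tr}\sqrt{X^\dagger X}.$$ *The protocol rDIPE.* Given states $\rho,\sigma$ on $n$ qubits and integers $N_1,N_2\ge1$, draw independent samples $\mathbf a_1,\dots,\mathbf a_{N_1}$ from $(q_\rho+q_\sigma)/2$. For each $i$, measure $P_{\mathbf a_i}$ independently on $N_2$ copies of $\rho$ and on $N_2$ copies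 of $\sigma$, and let $\alpha_i$, $\beta_i$ be the empirical means of the respective $\pm1$ outcomes. The output is $$f(\rho,\sigma,N_1,N_2)=\frac1{N_1}\sum_{i=1}^{N_1}\frac{2\alpha_i\beta_i}{\alpha_i^2\sqrt{B/A}+\beta_i^2\sqrt{A/B}},\qquad A=\operatorname{tr}\rho^2,\quad B=\operatorname{tr}\sigma^2,$$ where a term with $\alpha_i=\beta_i=0$ counts as $0$. $\mathbb P$ denotes the probability over this randomness, for fixed inputs. *The class CW.* $\mathrm{CW}(n)$ is the set of pure states $|\psi\rangle\langle\psi|$ with $|\psi\rangle=C|W_n\rangle$, where $|W_n\rangle=n^{-1/2}\sum_{z\in\{0,1\}^n,\ \sum_i z_i=1}|z\rangle$ and $C$ is a real Clifford unitary, i.e. a unitary matrix with real entries in the computational basis that maps every Pauli string to $\pm$ a Pauli string under conjugation. For a sequence $\{\rho\}=(\rho_n)_{n\ge1}$ write $\{\rho\}\in\mathrm{CW}$ if $\rho_n\in\mathrm{CW}(n)$ for all $n\ge1$. **Theorem.** Let $\{\rho\},\{\sigma\}\in\mathrm{CW}$. There exist positive integers $N_1=N_1(n,\tau,\delta)$ and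 $N_2=N_2(n,\tau,\delta)$, each bounded by a polynomial in $n$, $1/\tau$ and $\delta$, such that for all integers $n\ge1$ and all real $\tau,\delta>0$ $$\mathbb P\Big\{\big|f(\rho'_n,\sigma'_n,N_1,N_2)-c(\rho'_n,\sigma'_n)\big|>29\,\tau\Big\}<e^{-\delta}$$ for all sequences of states $\{\rho'\},\{\sigma'\}$ (possibly mixed and with non-real entries; $\rho'_m,\sigma'_m$ are states on $m$ qubits) with $\sup_{m\ge1}\|\rho_m-\rho'_m\|_{\mathrm{tr}}\le\tau$ and $\sup_{m\ge1}\|\sigma_m-\sigma'_m\|_{\mathrm{tr}}\le\tau$. -/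

import Mathlib

namespace RDIPE

open Matrix
open scoped Kronecker ComplexOrder

/-- Labels `z ∈ {0,1}ⁿ` of the computational basis of `n` qubits. -/
abbrev Bits (n : ℕ) : Type := Fin n → Fin 2

/-- Operators on `n` qubits, written in the computational basis. -/
abbrev Op (n : ℕ) : Type := Matrix (Bits n) (Bits n) ℂ

/-- Density matrices (possibly mixed, possibly non-real). -/
def IsState {n : ℕ} (ρ : Op n) : Prop := ρ.PosSemidef ∧ ρ.trace = 1

/-- The trace norm `tr √(Xᴴ X)`, i.e. the sum of the singular values of `X`. -/
noncomputable def traceNorm {n : ℕ} (X : Op n) : ℝ :=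
  ∑ i, Real.sqrt ((Matrix.isHermitian_conjTranspose_mul_self X).eigenvalues i)

/-- The single-qubit operators `1, X, Y, Z`. -/
noncomputable def pauli₁ : Fin 4 → Matrix (Fin 2) (Fin 2) ℂ :=
  ![1, !![0, 1; 1, 0], !![0, -Complex.I; Complex.I, 0], !![1, 0; 0, -1]]

/-- The Pauli string `P_a = P_{a₁} ⊗ ⋯ ⊗ P_{aₙ}`. -/
noncomputable def pauli {n : ℕ} (a : Fin n → Fin 4) : Op n :=
  Matrix.of fun z w => ∏ i, pauli₁ (a i) (z i) (w i)

/-- The maximally entangled vector `2^{-n/2} ∑_z |z⟩ ⊗ |z⟩`. -/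
noncomputable def bellZero (n : ℕ) : Bits n × Bits n → ℂ :=
  fun zw => if zw.1 = zw.2 then ((1 / Real.sqrt (2 ^ n) : ℝ) : ℂ) else 0

/-- The Bell vector `|Φ_a⟩ = (1 ⊗ P_a) |Φ_0⟩`. -/
noncomputable def bellVec {n : ℕ} (a : Fin n → Fin 4) : Bits n × Bits n → ℂ :=
  ((1 : Op n) ⊗ₖ pauli a) *ᵥ bellZero n

/-- The Bell distribution `q_ρ(a) = ⟨Φ_a| ρ ⊗ ρ |Φ_a⟩`. -/
noncomputable def bellDist {n : ℕ} (ρ : Op n) (a : Fin n → Fin 4) : ℝ :=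
  (star (bellVec a) ⬝ᵥ ((ρ ⊗ₖ ρ) *ᵥ bellVec a)).re

/-- The purity `tr ρ²`. -/
noncomputable def purity {n : ℕ} (ρ : Op n) : ℝ := (ρ * ρ).trace.re

/-- The target quantity `c(ρ, σ) = tr(ρσ) / √(tr ρ² tr σ²)`. -/
noncomputable def cosine {n : ℕ} (ρ σ : Op n) : ℝ :=
  (ρ * σ).trace.re / Real.sqrt (purity ρ * purity σ)

/-- The Born probability of outcome `s = ±1` when the observable `P_a` is measured on one copy
of `ρ`; the projector onto the `s`-eigenspace of `P_a` is `(1 + s P_a) / 2`. -/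
noncomputable def pauliOutcomeProb {n : ℕ} (ρ : Op n) (a : Fin n → Fin 4) (s : ℤˣ) : ℝ :=
  (ρ * ((1 / 2 : ℂ) • (1 + ((s : ℤ) : ℂ) • pauli a))).trace.re

/-- All measurement outcomes of one run of the protocol. -/
structure Transcript (n N₁ N₂ : ℕ) where
  /-- the Pauli labels obtained from the Bell measurements -/
  label : Fin N₁ → Fin n → Fin 4
  /-- Alice's single-copy outcomes, `N₂` of them for each label -/
  alice : Fin N₁ → Fin N₂ → ℤˣ
  /-- Bob's single-copy outcomes, `N₂` of them for each label -/
  bob : Fin N₁ → Fin N₂ → ℤˣ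

/-- Alice's empirical mean `α_i(N₂)`, the estimate of `⟨P_{a_i}⟩_ρ`. -/
noncomputable def Transcript.α {n N₁ N₂ : ℕ} (ω : Transcript n N₁ N₂) (i : Fin N₁) : ℝ :=
  (∑ j, ((ω.alice i j : ℤ) : ℝ)) / N₂

/-- Bob's empirical mean `β_i(N₂)`, the estimate of `⟨P_{a_i}⟩_σ`. -/
noncomputable def Transcript.β {n N₁ N₂ : ℕ} (ω : Transcript n N₁ N₂) (i : Fin N₁) : ℝ :=
  (∑ j, ((ω.bob i j : ℤ) : ℝ)) / N₂

/-- The output `f(ρ, σ, N₁, N₂)` of the protocol on a transcript, with `A = tr ρ²` and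
`B = tr σ²`. A term with `α_i = β_i = 0` counts as `0`. -/
noncomputable def estimator {n N₁ N₂ : ℕ} (ρ σ : Op n) (ω : Transcript n N₁ N₂) : ℝ :=
  (1 / (N₁ : ℝ)) * ∑ i, 2 * ω.α i * ω.β i /
    (ω.α i ^ 2 * Real.sqrt (purity σ / purity ρ) + ω.β i ^ 2 * Real.sqrt (purity ρ / purity σ))

/-- The probability of a transcript: the labels are independent samples of
`q_mix = (q_ρ + q_σ) / 2`, and given the labels all single-copy measurements are independent. -/
noncomputable def transcriptProb {n N₁ N₂ : ℕ} (ρ σ : Op n) (ω : Transcript n N₁ N₂) : ℝ :=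
  ∏ i, ((bellDist ρ (ω.label i) + bellDist σ (ω.label i)) / 2 *
    ((∏ j, pauliOutcomeProb ρ (ω.label i) (ω.alice i j)) *
      ∏ j, pauliOutcomeProb σ (ω.label i) (ω.bob i j)))

/-- Transcripts are triples of functions between finite types. -/
def transcriptEquiv (n N₁ N₂ : ℕ) : Transcript n N₁ N₂ ≃
    (Fin N₁ → Fin n → Fin 4) × (Fin N₁ → Fin N₂ → ℤˣ) × (Fin N₁ → Fin N₂ → ℤˣ) where
  toFun ω := (ω.label, ω.alice, ω.bob)
  invFun x := ⟨x.1, x.2.1, x.2.2⟩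
  left_inv _ := rfl
  right_inv _ := rfl

instance (n N₁ N₂ : ℕ) : Fintype (Transcript n N₁ N₂) :=
  Fintype.ofEquiv _ (transcriptEquiv n N₁ N₂).symm

/-- The probability of the event `E` over the randomness of one run of the protocol on inputs
`ρ`, `σ` with sample numbers `N₁`, `N₂`. -/
noncomputable def prob {n : ℕ} (ρ σ : Op n) (N₁ N₂ : ℕ) (E : Set (Transcript n N₁ N₂)) : ℝ :=
  ∑ ω, E.indicator (transcriptProb ρ σ) ω

/-- The real Clifford group on `n` qubits: unitary matrices with real entries that map every
Pauli string to a Pauli string up to sign under conjugation. -/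
def realClifford (n : ℕ) : Set (Op n) :=
  {C | C ∈ Matrix.unitaryGroup (Bits n) ℂ ∧ (∀ z w, (C z w).im = 0) ∧
    ∀ a : Fin n → Fin 4, ∃ (b : Fin n → Fin 4) (s : ℤˣ),
      C * pauli a * Cᴴ = ((s : ℤ) : ℂ) • pauli b}

/-- The `W`-state, `n^{-1/2}` times the sum of all `|z⟩` with `∑ᵢ zᵢ = 1`. -/
noncomputable def wState (n : ℕ) : Bits n → ℂ :=
  fun z => if ∑ i, (z i : ℕ) = 1 then ((1 / Real.sqrt n : ℝ) : ℂ) else 0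

/-- The class `CW(n)`, as density matrices `|ψ⟩⟨ψ|` with `|ψ⟩ = C |W_n⟩`, `C` real Clifford. -/
def CW (n : ℕ) : Set (Op n) :=
  {ρ | ∃ C ∈ realClifford n, ρ = vecMulVec (C *ᵥ wState n) (star (C *ᵥ wState n))}

/-- `N = poly(n, 1/τ, δ)`: bounded by a polynomial in `n`, `1/τ` and `δ`. -/
def IsPolyBounded (N : ℕ → ℝ → ℝ → ℕ) : Prop :=
  ∃ p : MvPolynomial (Fin 3) ℝ, ∀ (n : ℕ) (τ δ : ℝ), 0 < n → 0 < τ → 0 < δ →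
    (N n τ δ : ℝ) ≤ MvPolynomial.eval ![(n : ℝ), 1 / τ, δ] p

end RDIPE

namespace RDIPE

open Matrix
open scoped Kronecker ComplexOrder

/-! ### Pauli strings -/

/-! The cosine is itself an average of the summands of the estimator. By Parseval in the Pauli
basis, `c(ρ, σ)` is the mean of the exact ratio of `tr(ρ P_a)` and `tr(σ P_a)` when `a` follows the
mixture of the characteristic distributions `2⁻ⁿ tr(ρ P_a)² / tr ρ²` (`cosine_eq_sum`). The protocol
departs from this in three ways.

Wrong label distribution: for real pure states the Bell and characteristic distributions coincide
(`bellDist_pure`). Both are stable in trace norm, so for inputs τ-close to `CW` they differ by `12τ`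
in `ℓ¹` (`sum_abs_bellDist_sub_charDist_le`).

Estimated instead of exact expectations: the ratio is homogeneous of degree zero, so it is stable
only if the expectations are not both tiny. Expectations of `W_n` are multiples of `1/n`, and
Cliffords permute Pauli strings up to sign, so states in `CW` have expectations that vanish or are
at least `1/n` in modulus (`CW.properties`). Labels violating the threshold `1/(2n)` therefore have
mass at most `3τ` for each input (`sum_bellDist_small_le`); on the others, order `n²/τ²` copies make
the conditional bias at most `τ` (`abs_sum_outcomesProb_mul_sub_le`).

Finitely many labels: the summands lie in `[-1, 1]`, so a Chernoff bound with order `δ/τ²` labels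
for large `δ` costs another `τ`.

These estimates use `τ ≤ 2/29`. For larger `τ` the event is empty, since estimator and cosine both
lie in `[-1, 1]`. -/

theorem pauli₁_isHermitian (a : Fin 4) : (pauli₁ a).IsHermitian := by
  ext i j
  fin_cases a <;> fin_cases i <;> fin_cases j <;> simp [pauli₁]

theorem pauli₁_mul_self (a : Fin 4) : pauli₁ a * pauli₁ a = 1 := by
  ext i j
  fin_cases a <;> fin_cases i <;> fin_cases j <;> simp [pauli₁, Matrix.mul_apply]

theorem pauli₁_trace_mul {a b : Fin 4} (h : a ≠ b) : (pauli₁ a * pauli₁ b).trace = 0 := by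
  fin_cases a <;> fin_cases b <;>
    simp_all [pauli₁, Matrix.trace, Matrix.diag, Matrix.mul_apply, Matrix.one_apply]

theorem pauli₁_completeness (x y x' y' : Fin 2) :
    ∑ a, pauli₁ a x y * star (pauli₁ a x' y') = if x = x' ∧ y = y' then 2 else 0 := by
  fin_cases x <;> fin_cases y <;> fin_cases x' <;> fin_cases y' <;>
    simp [pauli₁, Fin.sum_univ_four] <;> norm_num

theorem pauli_apply {n : ℕ} (a : Fin n → Fin 4) (z w : Bits n) :
    pauli a z w = ∏ i, pauli₁ (a i) (z i) (w i) := rfl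

theorem pauli_isHermitian {n : ℕ} (a : Fin n → Fin 4) : (pauli a).IsHermitian := by
  ext z w
  simp only [conjTranspose_apply, pauli_apply, star_prod]
  exact Finset.prod_congr rfl fun i _ => (pauli₁_isHermitian (a i)).apply _ _

theorem pauli_mul_apply {n : ℕ} (a b : Fin n → Fin 4) (z w : Bits n) :
    (pauli a * pauli b) z w = ∏ i, (pauli₁ (a i) * pauli₁ (b i)) (z i) (w i) := by
  simp only [Matrix.mul_apply, pauli_apply, ← Finset.prod_mul_distrib]
  rw [Finset.prod_univ_sum, Fintype.piFinset_univ]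

theorem pauli_mul_self {n : ℕ} (a : Fin n → Fin 4) : pauli a * pauli a = 1 := by
  ext z w
  rw [pauli_mul_apply]
  simp only [pauli₁_mul_self, Matrix.one_apply]
  by_cases h : z = w
  · simp [h]
  · obtain ⟨i, hi⟩ := Function.ne_iff.mp h
    rw [if_neg h]
    exact Finset.prod_eq_zero (Finset.mem_univ i) (if_neg hi)

theorem pauli_trace_mul {n : ℕ} {a b : Fin n → Fin 4} (h : a ≠ b) :
    (pauli a * pauli b).trace = 0 := by
  have : (pauli a * pauli b).trace = ∏ i, (pauli₁ (a i) * pauli₁ (b i)).trace := by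
    simp only [Matrix.trace, Matrix.diag, pauli_mul_apply]
    rw [Finset.prod_univ_sum, Fintype.piFinset_univ]
  obtain ⟨i, hi⟩ := Function.ne_iff.mp h
  rw [this]
  exact Finset.prod_eq_zero (Finset.mem_univ i) (pauli₁_trace_mul hi)

/-- The sum factorizes over the qubits. Parseval (`sum_trace_mul_pauli`) and the resolution of the
identity by Bell vectors (`bellVec_completeness`) are both contractions of this identity. -/
theorem pauli_completeness {n : ℕ} (z w z' w' : Bits n) :
    ∑ a, pauli a z w * star (pauli a z' w') = if z = z' ∧ w = w' then 2 ^ n else 0 := by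
  simp only [pauli_apply, star_prod, ← Finset.prod_mul_distrib]
  have := Finset.prod_univ_sum (fun _ : Fin n => (Finset.univ : Finset (Fin 4)))
    (fun i a => pauli₁ a (z i) (w i) * star (pauli₁ a (z' i) (w' i)))
  rw [Fintype.piFinset_univ] at this
  rw [← this]
  simp only [pauli₁_completeness]
  by_cases h : z = z' ∧ w = w'
  · simp [h]
  · rw [if_neg h]
    have : ∃ i, ¬ (z i = z' i ∧ w i = w' i) := by
      by_contra! hc
      exact h ⟨funext fun i => (hc i).1, funext fun i => (hc i).2⟩
    obtain ⟨i, hi⟩ := this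
    exact Finset.prod_eq_zero (Finset.mem_univ i) (if_neg hi)

/-- Distinct strings are trace-orthogonal, whereas a string squares to the identity. This gives
injectivity of the Clifford action on labels. -/
theorem eq_of_pauli_eq_smul {n : ℕ} {a b : Fin n → Fin 4} {c : ℂ} (h : pauli a = c • pauli b) :
    a = b := by
  by_contra hab
  have h1 := pauli_trace_mul hab
  have hc : c ≠ 0 := by
    rintro rfl
    have := pauli_mul_self a
    rw [h, zero_smul, zero_mul] at this
    exact zero_ne_one this
  rw [h, smul_mul_assoc, pauli_mul_self, Matrix.trace_smul, Matrix.trace_one, smul_eq_mul] at h1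
  rcases mul_eq_zero.mp h1 with h2 | h2
  · exact hc h2
  · exact Fintype.card_ne_zero (Nat.cast_eq_zero.mp h2)

/-! ### Pauli expectations -/

/-- The Pauli expectation `tr(ρ P_a)`. -/
noncomputable def expect {n : ℕ} (ρ : Op n) (a : Fin n → Fin 4) : ℝ := (ρ * pauli a).trace.re

theorem trace_mul_im_eq_zero {n : ℕ} {A B : Op n} (hA : A.IsHermitian) (hB : B.IsHermitian) :
    (A * B).trace.im = 0 := by
  have : star (A * B).trace = (A * B).trace := by
    rw [← trace_conjTranspose, conjTranspose_mul, hA.eq, hB.eq, trace_mul_comm]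
  exact Complex.conj_eq_iff_im.mp this

theorem ofReal_expect {n : ℕ} {ρ : Op n} (hρ : ρ.IsHermitian) (a : Fin n → Fin 4) :
    (expect ρ a : ℂ) = (ρ * pauli a).trace :=
  Complex.ext (by simp [expect])
    (by simp [trace_mul_im_eq_zero hρ (pauli_isHermitian a)])

theorem sum_trace_mul_pauli {n : ℕ} (A B : Op n) :
    ∑ a, (A * pauli a).trace * (B * pauli a).trace = 2 ^ n * (A * B).trace := by
  -- Hermiticity turns the second Pauli entry into a conjugate, the form in which completeness
  -- applies.
  have key : ∀ a, (A * pauli a).trace * (B * pauli a).trace =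
      ∑ z, ∑ w, ∑ z', ∑ w', A z w * B z' w' * (pauli a w z * star (pauli a z' w')) := by
    intro a
    simp only [Matrix.trace, Matrix.diag, Matrix.mul_apply, Finset.sum_mul_sum]
    refine Finset.sum_congr rfl fun z _ => ?_
    rw [Finset.sum_comm]
    refine Finset.sum_congr rfl fun w _ => Finset.sum_congr rfl fun z' _ =>
      Finset.sum_congr rfl fun w' _ => ?_
    rw [(pauli_isHermitian a).apply]
    ring
  simp only [key]
  rw [Finset.sum_comm]
  simp only [Matrix.trace, Matrix.diag, Matrix.mul_apply, Finset.mul_sum]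
  refine Finset.sum_congr rfl fun z _ => ?_
  rw [Finset.sum_comm]
  refine Finset.sum_congr rfl fun w _ => ?_
  rw [Finset.sum_comm]
  have this : ∀ z', ∑ a, ∑ w', A z w * B z' w' * (pauli a w z * star (pauli a z' w')) =
      if z' = w then 2 ^ n * (A z w * B w z) else 0 := by
    intro z'
    rw [Finset.sum_comm]
    simp only [← Finset.mul_sum, pauli_completeness]
    by_cases h : w = z'
    · simp [h]; ring
    · simp [h, Ne.symm h]
  simp only [this, Finset.sum_ite_eq', Finset.mem_univ, if_true]

theorem sum_expect_mul {n : ℕ} {ρ σ : Op n} (hρ : ρ.IsHermitian) (hσ : σ.IsHermitian) :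
    ∑ a, expect ρ a * expect σ a = 2 ^ n * (ρ * σ).trace.re := by
  have h := sum_trace_mul_pauli ρ σ
  simp only [← ofReal_expect hρ, ← ofReal_expect hσ] at h
  have h2 : (ρ * σ).trace = ((ρ * σ).trace.re : ℂ) :=
    Complex.ext (by simp) (by simp [trace_mul_im_eq_zero hρ hσ])
  rw [h2] at h
  exact_mod_cast h

theorem sum_expect_sq {n : ℕ} {ρ : Op n} (hρ : ρ.IsHermitian) :
    ∑ a, expect ρ a ^ 2 = 2 ^ n * purity ρ := by
  simp only [sq]
  exact sum_expect_mul hρ hρ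

theorem expect_sub {n : ℕ} (ρ σ : Op n) (a : Fin n → Fin 4) :
    expect (ρ - σ) a = expect ρ a - expect σ a := by
  simp [expect, sub_mul]

/-! ### Trace norm -/

/-- The `ℓ²` norm of the singular values is at most their `ℓ¹` norm. -/
theorem purity_le_traceNorm_sq {n : ℕ} {X : Op n} (hX : X.IsHermitian) :
    purity X ≤ traceNorm X ^ 2 := by
  have hH := Matrix.isHermitian_conjTranspose_mul_self X
  have h1 : purity X = ∑ i, hH.eigenvalues i := by
    have := hH.trace_eq_sum_eigenvalues
    have h2 : X * X = Xᴴ * X := by rw [hX.eq]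
    rw [purity, h2, this]
    simp
  have hnn : ∀ i, 0 ≤ hH.eigenvalues i := Matrix.eigenvalues_conjTranspose_mul_self_nonneg X
  rw [h1]
  calc ∑ i, hH.eigenvalues i = ∑ i, Real.sqrt (hH.eigenvalues i) ^ 2 :=
        Finset.sum_congr rfl fun i _ => (Real.sq_sqrt (hnn i)).symm
    _ ≤ (∑ i, Real.sqrt (hH.eigenvalues i)) ^ 2 :=
        Finset.sum_sq_le_sq_sum_of_nonneg fun i _ => Real.sqrt_nonneg _
    _ = traceNorm X ^ 2 := rfl

theorem traceNorm_nonneg {n : ℕ} (X : Op n) : 0 ≤ traceNorm X :=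
  Finset.sum_nonneg fun _ _ => Real.sqrt_nonneg _

open scoped MatrixOrder in
/-- The absolute value of a Hermitian matrix dominates it and has the trace norm as its trace. -/
theorem exists_posSemidef_dominating {n : ℕ} {D : Op n} (hD : D.IsHermitian) :
    ∃ M : Op n, (M - D).PosSemidef ∧ (M + D).PosSemidef ∧ M.trace.re = traceNorm D := by
  have hH := Matrix.isHermitian_conjTranspose_mul_self D
  have hD' : IsSelfAdjoint D := hD
  -- Since `Dᴴ * D = D ^ 2`, this witness is `|D|`, and the two positivity claims reduce to `|x| ± x
  -- ≥ 0` in the functional calculus of `D`.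
  refine ⟨cfc Real.sqrt (Dᴴ * D), ?_, ?_, ?_⟩
  · have h1 : cfc Real.sqrt (Dᴴ * D) - D = cfc (fun x : ℝ => |x| - x) D := by
      rw [cfc_sub (fun x : ℝ => |x|) (fun x : ℝ => x) D, cfc_id' ℝ D, hD.eq, ← sq,
        ← cfc_pow_id (R := ℝ) D 2, ← cfc_comp' Real.sqrt (fun x : ℝ => x ^ 2) D]
      simp only [Real.sqrt_sq_eq_abs]
    rw [h1, ← Matrix.nonneg_iff_posSemidef]
    exact cfc_nonneg fun x _ => sub_nonneg.mpr (le_abs_self x)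
  · have h1 : cfc Real.sqrt (Dᴴ * D) + D = cfc (fun x : ℝ => |x| + x) D := by
      rw [cfc_add (fun x : ℝ => |x|) (fun x : ℝ => x) (a := D), cfc_id' ℝ D, hD.eq, ← sq,
        ← cfc_pow_id (R := ℝ) D 2, ← cfc_comp' Real.sqrt (fun x : ℝ => x ^ 2) D]
      simp only [Real.sqrt_sq_eq_abs]
    rw [h1, ← Matrix.nonneg_iff_posSemidef]
    exact cfc_nonneg fun x _ => by linarith [neg_abs_le x]
  · rw [hH.cfc_eq, Matrix.IsHermitian.cfc, Unitary.conjStarAlgAut_apply, Matrix.trace_mul_cycle,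
      Unitary.coe_star_mul_self, one_mul, Matrix.trace_diagonal]
    simp [traceNorm]

/-! ### The Bell basis -/

theorem bellVec_apply {n : ℕ} (a : Fin n → Fin 4) (p : Bits n × Bits n) :
    bellVec a p = pauli a p.2 p.1 * ((1 / Real.sqrt (2 ^ n) : ℝ) : ℂ) := by
  obtain ⟨z, w⟩ := p
  simp only [bellVec, mulVec, dotProduct, Fintype.sum_prod_type, bellZero, kroneckerMap_apply,
    Matrix.one_apply]
  simp

theorem bellVec_completeness {n : ℕ} (p q : Bits n × Bits n) :
    ∑ a, bellVec a p * star (bellVec a q) = if p = q then 1 else 0 := by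
  have hc : ((1 / Real.sqrt (2 ^ n) : ℝ) : ℂ) * ((1 / Real.sqrt (2 ^ n) : ℝ) : ℂ) * 2 ^ n = 1 := by
    have : (1 / Real.sqrt (2 ^ n)) * (1 / Real.sqrt (2 ^ n)) * (2 ^ n : ℝ) = 1 := by
      rw [div_mul_div_comm, Real.mul_self_sqrt (by positivity)]
      field_simp
    exact_mod_cast this
  have h : ∀ a, bellVec a p * star (bellVec a q) =
      ((1 / Real.sqrt (2 ^ n) : ℝ) : ℂ) * ((1 / Real.sqrt (2 ^ n) : ℝ) : ℂ) *
        (pauli a p.2 p.1 * star (pauli a q.2 q.1)) := by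
    intro a
    rw [bellVec_apply, bellVec_apply, star_mul', Complex.star_def,
      Complex.conj_ofReal]
    ring
  simp only [h, ← Finset.mul_sum, pauli_completeness]
  by_cases hpq : p = q
  · subst hpq
    simpa using hc
  · have : ¬ (p.2 = q.2 ∧ p.1 = q.1) := fun hh => hpq (Prod.ext hh.2 hh.1)
    simp [hpq, this]

/-- The expectation `⟨Φ_a| M |Φ_a⟩` of a two-register operator. -/
noncomputable def bellForm {n : ℕ} (M : Matrix (Bits n × Bits n) (Bits n × Bits n) ℂ)
    (a : Fin n → Fin 4) : ℝ :=
  (star (bellVec a) ⬝ᵥ (M *ᵥ bellVec a)).re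

theorem bellForm_add {n : ℕ} (M N : Matrix (Bits n × Bits n) (Bits n × Bits n) ℂ)
    (a : Fin n → Fin 4) : bellForm (M + N) a = bellForm M a + bellForm N a := by
  simp [bellForm, add_mulVec, dotProduct_add]

theorem bellForm_sub {n : ℕ} (M N : Matrix (Bits n × Bits n) (Bits n × Bits n) ℂ)
    (a : Fin n → Fin 4) : bellForm (M - N) a = bellForm M a - bellForm N a := by
  simp [bellForm, sub_mulVec, dotProduct_sub]

theorem bellForm_nonneg {n : ℕ} {M : Matrix (Bits n × Bits n) (Bits n × Bits n) ℂ}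
    (hM : M.PosSemidef) (a : Fin n → Fin 4) : 0 ≤ bellForm M a :=
  hM.re_dotProduct_nonneg (bellVec a)

theorem sum_bellForm {n : ℕ} (M : Matrix (Bits n × Bits n) (Bits n × Bits n) ℂ) :
    ∑ a, bellForm M a = M.trace.re := by
  simp only [bellForm, ← Complex.re_sum]
  congr 1
  simp only [dotProduct, mulVec, Finset.mul_sum, Pi.star_apply]
  rw [Finset.sum_comm]
  simp only [Matrix.trace, Matrix.diag]
  refine Finset.sum_congr rfl fun p _ => ?_
  rw [Finset.sum_comm]
  have h : ∀ q, ∑ a, star (bellVec a p) * (M p q * bellVec a q) = if q = p then M p q else 0 := by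
    intro q
    have : ∀ a : Fin n → Fin 4, star (bellVec a p) * (M p q * bellVec a q) =
        M p q * (bellVec a q * star (bellVec a p)) := fun a => by ring
    simp only [this, ← Finset.mul_sum, bellVec_completeness]
    simp
  simp only [h, Finset.sum_ite_eq', Finset.mem_univ, if_true]

theorem bellDist_eq_bellForm {n : ℕ} (ρ : Op n) (a : Fin n → Fin 4) :
    bellDist ρ a = bellForm (ρ ⊗ₖ ρ) a := rfl

theorem bellDist_nonneg {n : ℕ} {ρ : Op n} (hρ : ρ.PosSemidef) (a : Fin n → Fin 4) :
    0 ≤ bellDist ρ a :=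
  bellForm_nonneg (hρ.kronecker hρ) a

theorem sum_bellDist {n : ℕ} {ρ : Op n} (hρ : IsState ρ) : ∑ a, bellDist ρ a = 1 := by
  simp only [bellDist_eq_bellForm]
  rw [sum_bellForm, trace_kronecker, hρ.2]
  simp

/-- From `-M ≤ X ≤ M` each Bell expectation of `X` is bounded by that of `M`, and the latter sum to
the trace. This is how trace distance controls the measured distributions. -/
theorem sum_abs_bellForm_le {n : ℕ} {M X : Matrix (Bits n × Bits n) (Bits n × Bits n) ℂ}
    (h₁ : (M - X).PosSemidef) (h₂ : (M + X).PosSemidef) :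
    ∑ a, |bellForm X a| ≤ M.trace.re := by
  rw [← sum_bellForm]
  refine Finset.sum_le_sum fun a _ => abs_le.mpr ⟨?_, ?_⟩
  · have := bellForm_nonneg h₂ a
    rw [bellForm_add] at this
    linarith
  · have := bellForm_nonneg h₁ a
    rw [bellForm_sub] at this
    linarith

theorem sub_kronecker' {n : ℕ} (A B C : Op n) : (A - B) ⊗ₖ C = A ⊗ₖ C - B ⊗ₖ C := by
  ext p q
  simp [sub_mul]

theorem kronecker_sub' {n : ℕ} (A B C : Op n) : A ⊗ₖ (B - C) = A ⊗ₖ B - A ⊗ₖ C := by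
  ext p q
  simp [mul_sub]

/-- Telescope `ρ ⊗ ρ - σ ⊗ σ = (ρ - σ) ⊗ ρ + σ ⊗ (ρ - σ)`; with `M = |ρ - σ|` the two terms are
dominated by `M ⊗ ρ` and `σ ⊗ M`. -/
theorem sum_abs_bellDist_sub_le {n : ℕ} {ρ σ : Op n} (hρ : IsState ρ) (hσ : IsState σ) :
    ∑ a, |bellDist ρ a - bellDist σ a| ≤ 2 * traceNorm (ρ - σ) := by
  obtain ⟨M, h₁, h₂, hM⟩ := exists_posSemidef_dominating (hρ.1.isHermitian.sub hσ.1.isHermitian)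
  have e₁ : ∑ a, |bellForm ((ρ - σ) ⊗ₖ ρ) a| ≤ traceNorm (ρ - σ) := by
    have := sum_abs_bellForm_le (M := M ⊗ₖ ρ) (X := (ρ - σ) ⊗ₖ ρ)
      (by rw [← sub_kronecker']; exact h₁.kronecker hρ.1)
      (by rw [← add_kronecker]; exact h₂.kronecker hρ.1)
    rwa [trace_kronecker, hρ.2, mul_one, hM] at this
  have e₂ : ∑ a, |bellForm (σ ⊗ₖ (ρ - σ)) a| ≤ traceNorm (ρ - σ) := by
    have := sum_abs_bellForm_le (M := σ ⊗ₖ M) (X := σ ⊗ₖ (ρ - σ))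
      (by rw [← kronecker_sub']; exact hσ.1.kronecker h₁)
      (by rw [← kronecker_add]; exact hσ.1.kronecker h₂)
    rwa [trace_kronecker, hσ.2, one_mul, hM] at this
  calc ∑ a, |bellDist ρ a - bellDist σ a|
      ≤ ∑ a, (|bellForm ((ρ - σ) ⊗ₖ ρ) a| + |bellForm (σ ⊗ₖ (ρ - σ)) a|) := by
        refine Finset.sum_le_sum fun a _ => ?_
        have : bellDist ρ a - bellDist σ a =
            bellForm ((ρ - σ) ⊗ₖ ρ) a + bellForm (σ ⊗ₖ (ρ - σ)) a := by
          rw [sub_kronecker', kronecker_sub', bellForm_sub, bellForm_sub, bellDist_eq_bellForm,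
            bellDist_eq_bellForm]
          ring
        rw [this]
        exact abs_add_le _ _
    _ ≤ 2 * traceNorm (ρ - σ) := by
        rw [Finset.sum_add_distrib]
        linarith

/-- For a real pure state, the Bell distribution consists of the squared Pauli expectations. -/
theorem bellDist_pure {n : ℕ} {ψ : Bits n → ℂ} (hψ : star ψ = ψ) (a : Fin n → Fin 4) :
    2 ^ n * bellDist (vecMulVec ψ (star ψ)) a = expect (vecMulVec ψ (star ψ)) a ^ 2 := by
  set Ψ : Bits n × Bits n → ℂ := fun p => ψ p.1 * ψ p.2 with hΨ
  have hstar : ∀ z, star (ψ z) = ψ z := fun z => congrFun hψ z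
  have hk : vecMulVec ψ (star ψ) ⊗ₖ vecMulVec ψ (star ψ) = vecMulVec Ψ Ψ := by
    ext p q
    simp only [kroneckerMap_apply, vecMulVec_apply, hΨ, Pi.star_apply, hstar]
    ring
  -- Reality of `ψ` is essential here: the Bell overlap involves `ψ z * ψ w`, the Pauli expectation
  -- `ψ z * star (ψ w)`.
  have ht : Ψ ⬝ᵥ bellVec a =
      (vecMulVec ψ (star ψ) * pauli a).trace * ((1 / Real.sqrt (2 ^ n) : ℝ) : ℂ) := by
    simp only [dotProduct, Fintype.sum_prod_type, bellVec_apply, Matrix.trace, Matrix.diag,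
      Matrix.mul_apply, vecMulVec_apply, Finset.sum_mul, hΨ, Pi.star_apply, hstar]
    refine Finset.sum_congr rfl fun z _ => Finset.sum_congr rfl fun w _ => ?_
    ring
  rw [← ofReal_expect (posSemidef_vecMulVec_self_star ψ).isHermitian, ← Complex.ofReal_mul] at ht
  have ht' : star (bellVec a) ⬝ᵥ Ψ = star (Ψ ⬝ᵥ bellVec a) := by
    rw [star_dotProduct]
    have : star Ψ = Ψ := funext fun p => by simp only [hΨ, Pi.star_apply, star_mul', hstar]
    rw [this]
  rw [bellDist, hk, vecMulVec_mulVec, dotProduct_smul, ht', ht, Complex.star_def,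
    Complex.conj_ofReal, op_smul_eq_mul, ← Complex.ofReal_mul, Complex.ofReal_re]
  have : (1 / Real.sqrt (2 ^ n)) * (1 / Real.sqrt (2 ^ n)) * (2 ^ n : ℝ) = 1 := by
    rw [div_mul_div_comm, Real.mul_self_sqrt (by positivity)]
    field_simp
  linear_combination expect (vecMulVec ψ (star ψ)) a ^ 2 * this

/-! ### Single-copy Pauli measurements -/

theorem pauliOutcomeProb_eq {n : ℕ} {ρ : Op n} (hρ : IsState ρ) (a : Fin n → Fin 4) (s : ℤˣ) :
    pauliOutcomeProb ρ a s = (1 + ((s : ℤ) : ℝ) * expect ρ a) / 2 := by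
  have : (ρ * ((1 / 2 : ℂ) • (1 + ((s : ℤ) : ℂ) • pauli a))).trace =
      ((1 / 2 : ℝ) : ℂ) * (1 + (((s : ℤ) : ℝ) : ℂ) * (ρ * pauli a).trace) := by
    rw [mul_smul_comm, mul_add, mul_one, mul_smul_comm, trace_smul, trace_add, trace_smul, hρ.2]
    simp
  rw [pauliOutcomeProb, this, Complex.re_ofReal_mul, Complex.add_re, Complex.re_ofReal_mul]
  simp only [Complex.one_re, expect]
  ring

/-- `Q = (1 + s P_a) / 2` is an orthogonal projection, so `tr(ρ Q) = tr(Q ρ Qᴴ)`. -/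
theorem pauliOutcomeProb_nonneg {n : ℕ} {ρ : Op n} (hρ : ρ.PosSemidef) (a : Fin n → Fin 4)
    (s : ℤˣ) : 0 ≤ pauliOutcomeProb ρ a s := by
  set Q : Op n := (1 / 2 : ℂ) • (1 + ((s : ℤ) : ℂ) • pauli a) with hQ
  have hs : ((s : ℤ) : ℂ) * ((s : ℤ) : ℂ) = 1 := by
    rcases Int.units_eq_one_or s with rfl | rfl <;> simp
  have hH : Qᴴ = Q := by
    rw [hQ, conjTranspose_smul, conjTranspose_add, conjTranspose_one, conjTranspose_smul,
      (pauli_isHermitian a).eq]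
    simp
  have hQQ : Q * Q = Q := by
    rw [hQ, smul_mul_smul_comm, add_mul, one_mul, mul_add, mul_one, smul_mul_smul_comm, hs,
      pauli_mul_self, one_smul]
    module
  have h := (hρ.mul_mul_conjTranspose_same Q).trace_nonneg
  rw [hH, trace_mul_comm, ← mul_assoc, hQQ, trace_mul_comm] at h
  exact (Complex.le_def.mp h).1

/-! ### The class CW -/

theorem card_weight_one (n : ℕ) :
    (Finset.univ.filter fun z : Bits n => ∑ i, (z i : ℕ) = 1).card = n := by
  have : (Finset.univ.filter fun z : Bits n => ∑ i, (z i : ℕ) = 1) =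
      Finset.univ.image fun i : Fin n => (Pi.single i 1 : Bits n) := by
    ext z
    simp only [Finset.mem_filter, Finset.mem_univ, true_and, Finset.mem_image]
    constructor
    · intro h
      have : ∃ i, z i ≠ 0 := by
        by_contra! hc
        simp [hc] at h
      obtain ⟨i, hi⟩ := this
      refine ⟨i, ?_⟩
      have hi1 : z i = 1 := by omega
      rw [← Finset.add_sum_erase _ _ (Finset.mem_univ i), hi1] at h
      have h0 : ∑ j ∈ Finset.univ.erase i, (z j : ℕ) = 0 := by
        simpa using h
      ext j
      by_cases hj : j = i
      · subst hj; simp [hi1]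
      · have := Finset.sum_eq_zero_iff.mp h0 j (by simp [hj])
        simp [hj, this]
    · rintro ⟨i, rfl⟩
      rw [Finset.sum_eq_single i] <;> simp +contextual
  rw [this, Finset.card_image_of_injective, Finset.card_univ, Fintype.card_fin]
  intro i j hij
  by_contra hne
  have := congrFun hij i
  simp [hne] at this

theorem star_wState (n : ℕ) : star (wState n) = wState n := by
  ext z
  simp only [wState, Pi.star_apply]
  split_ifs <;> simp

/-- Multiplying by `n` clears the square roots and leaves a 0/1 matrix. With Pauli entries in the
Gaussian integers, this makes the expectations of `W_n` integral after scaling. -/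
theorem wState_mul_wState {n : ℕ} (hn : 0 < n) (z w : Bits n) :
    (n : ℂ) * (wState n z * wState n w) =
      if ∑ i, (z i : ℕ) = 1 ∧ ∑ i, (w i : ℕ) = 1 then 1 else 0 := by
  have h : (n : ℂ) * (((1 / Real.sqrt n : ℝ) : ℂ) * ((1 / Real.sqrt n : ℝ) : ℂ)) = 1 := by
    have : (n : ℝ) * ((1 / Real.sqrt n) * (1 / Real.sqrt n)) = 1 := by
      rw [div_mul_div_comm, Real.mul_self_sqrt (by positivity)]
      field_simp
    exact_mod_cast this
  by_cases h₁ : ∑ i, (z i : ℕ) = 1 <;> by_cases h₂ : ∑ i, (w i : ℕ) = 1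
  · simpa only [wState, h₁, h₂, and_self, if_true] using h
  all_goals simp [wState, h₁, h₂]

theorem star_wState_dotProduct {n : ℕ} (hn : 0 < n) : star (wState n) ⬝ᵥ wState n = 1 := by
  have hn' : (n : ℂ) ≠ 0 := Nat.cast_ne_zero.mpr hn.ne'
  apply mul_left_cancel₀ hn'
  rw [star_wState, dotProduct, Finset.mul_sum]
  simp only [wState_mul_wState hn, and_self, Finset.sum_boole, card_weight_one, mul_one]

theorem pauli_mem_range_gaussianInt {n : ℕ} (a : Fin n → Fin 4) (z w : Bits n) :
    pauli a z w ∈ GaussianInt.toComplex.range := by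
  have h : ∀ (a : Fin 4) (x y : Fin 2), pauli₁ a x y ∈ GaussianInt.toComplex.range := by
    have hI : Complex.I ∈ GaussianInt.toComplex.range :=
      ⟨⟨0, 1⟩, by rw [GaussianInt.toComplex_def']; simp⟩
    intro a x y
    fin_cases a <;> fin_cases x <;> fin_cases y <;>
      simp [pauli₁, -RingHom.mem_range, zero_mem, one_mem, hI]
  rw [pauli_apply]
  exact prod_mem fun i _ => h _ _ _

/-- The Pauli expectations of the `W`-state are integer multiples of `1 / n`. -/
theorem exists_int_eq_expect_wState {n : ℕ} (hn : 0 < n) (a : Fin n → Fin 4) :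
    ∃ k : ℤ, (n : ℝ) * expect (vecMulVec (wState n) (star (wState n))) a = k := by
  have h : (n : ℂ) * (vecMulVec (wState n) (star (wState n)) * pauli a).trace ∈
      GaussianInt.toComplex.range := by
    simp only [Matrix.trace, Matrix.diag, Matrix.mul_apply, vecMulVec_apply, Finset.mul_sum,
      star_wState]
    refine sum_mem fun z _ => sum_mem fun w _ => ?_
    rw [← mul_assoc, wState_mul_wState hn]
    refine mul_mem ?_ (pauli_mem_range_gaussianInt a w z)
    split_ifs
    exacts [one_mem _, zero_mem _]
  obtain ⟨x, hx⟩ := h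
  refine ⟨x.re, ?_⟩
  rw [GaussianInt.intCast_re, hx, ← Complex.ofReal_natCast, Complex.re_ofReal_mul, expect]

/-- Conjugation by a Clifford unitary permutes the Pauli strings up to sign. -/
theorem exists_clifford_conj_eq {n : ℕ} {C : Op n} (hC : C ∈ realClifford n)
    (b : Fin n → Fin 4) :
    ∃ (a : Fin n → Fin 4) (s : ℤˣ), pauli b = ((s : ℤ) : ℂ) • (C * pauli a * Cᴴ) := by
  obtain ⟨hU, -, hP⟩ := hC
  have hU' : Cᴴ * C = 1 := (Matrix.mem_unitaryGroup_iff'.mp hU)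
  choose f s hf using hP
  have hs : ∀ u : ℤˣ, ((u : ℤ) : ℂ) * ((u : ℤ) : ℂ) = 1 := fun u => by
    rcases Int.units_eq_one_or u with rfl | rfl <;> simp
  have hf' : ∀ a, pauli (f a) = ((s a : ℤ) : ℂ) • (C * pauli a * Cᴴ) := fun a => by
    rw [hf, smul_smul, hs, one_smul]
  have hback : ∀ a, Cᴴ * pauli (f a) * C = ((s a : ℤ) : ℂ) • pauli a := fun a => by
    rw [hf', mul_smul_comm, smul_mul_assoc]
    congr 1
    calc Cᴴ * (C * pauli a * Cᴴ) * C = (Cᴴ * C) * pauli a * (Cᴴ * C) := by noncomm_ring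
      _ = pauli a := by rw [hU', one_mul, mul_one]
  -- Conjugating back recovers the string up to sign, so `f` is injective; on the finite set of
  -- labels it is then surjective, which supplies the preimage of `b`.
  have hinj : Function.Injective f := fun a a' h => by
    have h1 := hback a
    rw [h, hback a'] at h1
    refine eq_of_pauli_eq_smul (c := ((s a : ℤ) : ℂ) * ((s a' : ℤ) : ℂ)) ?_
    rw [← smul_smul, h1, smul_smul, hs, one_smul]
  obtain ⟨a, rfl⟩ := (Finite.surjective_of_injective hinj) b
  exact ⟨a, s a, hf' a⟩

/-- The properties of the states in `CW` on which the protocol relies. -/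
theorem CW.properties {n : ℕ} (hn : 0 < n) {ρ : Op n} (hρ : ρ ∈ CW n) :
    IsState ρ ∧ purity ρ = 1 ∧ (∀ a, 2 ^ n * bellDist ρ a = expect ρ a ^ 2) ∧
      ∀ a, expect ρ a = 0 ∨ 1 / (n : ℝ) ≤ |expect ρ a| := by
  obtain ⟨C, hC, rfl⟩ := hρ
  have hU' : Cᴴ * C = 1 := (Matrix.mem_unitaryGroup_iff'.mp hC.1)
  set ψ := C *ᵥ wState n with hψ
  have hnorm : star ψ ⬝ᵥ ψ = 1 := by
    rw [hψ, star_mulVec, dotProduct_mulVec, vecMul_vecMul, hU', vecMul_one,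
      star_wState_dotProduct hn]
  have hreal : star ψ = ψ := by
    ext z
    simp only [hψ, mulVec, dotProduct, Pi.star_apply, star_sum, star_mul']
    refine Finset.sum_congr rfl fun w _ => ?_
    rw [Complex.star_def, Complex.conj_eq_iff_im.mpr (hC.2.1 z w), ← Complex.star_def]
    congr 1
    exact congrFun (star_wState n) w
  refine ⟨⟨posSemidef_vecMulVec_self_star ψ, ?_⟩, ?_, bellDist_pure hreal, fun b => ?_⟩
  · rw [trace_vecMulVec, dotProduct_comm, hnorm]
  · rw [purity, vecMulVec_mul_vecMulVec, hnorm, one_smul, trace_vecMulVec, dotProduct_comm, hnorm,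
      Complex.one_re]
  · obtain ⟨a, s, hs⟩ := exists_clifford_conj_eq hC b
    have hV : vecMulVec ψ (star ψ) = C * vecMulVec (wState n) (star (wState n)) * Cᴴ := by
      rw [mul_vecMulVec, vecMulVec_mul, hψ, star_mulVec]
    have he : (vecMulVec ψ (star ψ) * pauli b).trace = (((s : ℤ) : ℝ) : ℂ) *
        (vecMulVec (wState n) (star (wState n)) * pauli a).trace := by
      rw [hs, mul_smul_comm, trace_smul, hV, smul_eq_mul]
      congr 1
      rw [show ∀ V P : Op n, C * V * Cᴴ * (C * P * Cᴴ) = C * (V * (Cᴴ * C) * P) * Cᴴ from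
        fun V P => by noncomm_ring, hU', mul_one, trace_mul_cycle, hU', one_mul]
    have he' : expect (vecMulVec ψ (star ψ)) b =
        ((s : ℤ) : ℝ) * expect (vecMulVec (wState n) (star (wState n))) a := by
      rw [expect, he, Complex.re_ofReal_mul, expect]
    obtain ⟨k, hk⟩ := exists_int_eq_expect_wState hn a
    have hn' : (0 : ℝ) < n := Nat.cast_pos.mpr hn
    have habs : (n : ℝ) * |expect (vecMulVec ψ (star ψ)) b| = |(k : ℝ)| := by
      rw [he', abs_mul, ← hk, abs_mul, abs_of_pos hn']
      rcases Int.units_eq_one_or s with rfl | rfl <;> simp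
    by_cases hk0 : k = 0
    · left
      rw [hk0, Int.cast_zero, abs_zero] at habs
      exact abs_eq_zero.mp ((mul_eq_zero.mp habs).resolve_left hn'.ne')
    · right
      rw [div_le_iff₀ hn', mul_comm, habs, ← Int.cast_abs]
      exact_mod_cast Int.one_le_abs hk0

/-! ### Finite product distributions -/

section ProductDistribution

variable {X : Type*} [Fintype X]

theorem sum_prod_eq_one {w : X → ℝ} (hw : ∑ x, w x = 1) (N : ℕ) :
    ∑ x : Fin N → X, ∏ i, w (x i) = 1 := by
  rw [← Fintype.sum_pow, hw, one_pow]

theorem sum_fin_succ_fun {N : ℕ} (F : (Fin (N + 1) → X) → ℝ) :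
    ∑ x, F x = ∑ x₀, ∑ x : Fin N → X, F (Fin.cons x₀ x) := by
  rw [← Fintype.sum_prod_type', ← (Fin.consEquiv fun _ => X).sum_comp]
  rfl

theorem sum_prod_mul_sum_eq_zero {w h : X → ℝ} (hw : ∑ x, w x = 1) (h₀ : ∑ x, w x * h x = 0)
    (N : ℕ) : ∑ x : Fin N → X, (∏ i, w (x i)) * ∑ i, h (x i) = 0 := by
  induction N with
  | zero => simp
  | succ N ih =>
    rw [sum_fin_succ_fun]
    simp only [Fin.prod_univ_succ, Fin.sum_univ_succ, Fin.cons_zero, Fin.cons_succ]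
    have : ∀ x₀ : X, ∑ x : Fin N → X, (w x₀ * ∏ i, w (x i)) * (h x₀ + ∑ i, h (x i)) =
        w x₀ * h x₀ := by
      intro x₀
      calc _ = w x₀ * h x₀ * (∑ x : Fin N → X, ∏ i, w (x i)) +
            w x₀ * ∑ x : Fin N → X, (∏ i, w (x i)) * ∑ i, h (x i) := by
            rw [Finset.mul_sum, Finset.mul_sum, ← Finset.sum_add_distrib]
            exact Finset.sum_congr rfl fun x _ => by ring
        _ = _ := by rw [ih, sum_prod_eq_one hw, mul_one, mul_zero, add_zero]
    simp only [this, h₀]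

/-- The variance of a sum of independent centred variables is additive. -/
theorem sum_prod_mul_sum_sq {w h : X → ℝ} (hw : ∑ x, w x = 1) (h₀ : ∑ x, w x * h x = 0)
    (N : ℕ) : ∑ x : Fin N → X, (∏ i, w (x i)) * (∑ i, h (x i)) ^ 2 =
      N * ∑ x, w x * h x ^ 2 := by
  induction N with
  | zero => simp
  | succ N ih =>
    rw [sum_fin_succ_fun]
    simp only [Fin.prod_univ_succ, Fin.sum_univ_succ, Fin.cons_zero, Fin.cons_succ]
    have : ∀ x₀ : X, ∑ x : Fin N → X, (w x₀ * ∏ i, w (x i)) * (h x₀ + ∑ i, h (x i)) ^ 2 =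
        w x₀ * h x₀ ^ 2 + w x₀ * (N * ∑ x, w x * h x ^ 2) := by
      intro x₀
      calc _ = w x₀ * h x₀ ^ 2 * (∑ x : Fin N → X, ∏ i, w (x i)) +
            2 * (w x₀ * h x₀) * (∑ x : Fin N → X, (∏ i, w (x i)) * ∑ i, h (x i)) +
            w x₀ * ∑ x : Fin N → X, (∏ i, w (x i)) * (∑ i, h (x i)) ^ 2 := by
            rw [Finset.mul_sum, Finset.mul_sum, Finset.mul_sum, ← Finset.sum_add_distrib,
              ← Finset.sum_add_distrib]
            exact Finset.sum_congr rfl fun x _ => by ring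
        _ = _ := by
            rw [ih, sum_prod_eq_one hw, sum_prod_mul_sum_eq_zero hw h₀, mul_one, mul_zero,
              add_zero]
    simp only [this, Finset.sum_add_distrib, ← Finset.sum_mul, hw]
    push_cast
    ring

theorem exp_le_one_add_add_sq {x : ℝ} (hx : |x| ≤ 1) : Real.exp x ≤ 1 + x + x ^ 2 := by
  have := (abs_le.mp (Real.abs_exp_sub_one_sub_id_le hx)).2
  linarith

/-- Exponential Markov inequality with `l = t / 8`, the minimizer of `4 l² - l t`. The condition `t
≤ 4` ensures `|l h| ≤ 1`, where `exp x ≤ 1 + x + x²` is available. -/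
theorem sum_prod_indicator_le_exp {w h : X → ℝ} (hw₀ : ∀ x, 0 ≤ w x) (hw : ∑ x, w x = 1)
    (h₀ : ∑ x, w x * h x = 0) (hh : ∀ x, |h x| ≤ 2) {t : ℝ} (ht : 0 ≤ t) (ht' : t ≤ 4) (N : ℕ) :
    ∑ x : Fin N → X, {x : Fin N → X | N * t < ∑ i, h (x i)}.indicator
      (fun x => ∏ i, w (x i)) x ≤ Real.exp (-(N * t ^ 2 / 16)) := by
  set l : ℝ := t / 8 with hl
  have hl0 : 0 ≤ l := by positivity
  have hmgf : ∑ x, w x * Real.exp (l * h x) ≤ Real.exp (4 * l ^ 2) := by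
    have : ∀ x, w x * Real.exp (l * h x) ≤ w x + l * (w x * h x) + w x * (4 * l ^ 2) := by
      intro x
      have hx : |l * h x| ≤ 1 := by
        rw [abs_mul, abs_of_nonneg hl0]
        nlinarith [hh x, abs_nonneg (h x)]
      have h1 := exp_le_one_add_add_sq hx
      have h2 : h x ^ 2 ≤ 4 := by
        rw [← sq_abs]
        nlinarith [hh x, abs_nonneg (h x)]
      have h3 : (l * h x) ^ 2 ≤ 4 * l ^ 2 := by
        rw [mul_pow]
        nlinarith [sq_nonneg l]
      nlinarith [hw₀ x, mul_le_mul_of_nonneg_left (h1.trans (add_le_add_right h3 _)) (hw₀ x)]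
    calc _ ≤ ∑ x, (w x + l * (w x * h x) + w x * (4 * l ^ 2)) :=
          Finset.sum_le_sum fun x _ => this x
      _ = 1 + 4 * l ^ 2 := by
          rw [Finset.sum_add_distrib, Finset.sum_add_distrib, ← Finset.mul_sum, h₀,
            ← Finset.sum_mul, hw]
          ring
      _ ≤ _ := by linarith [Real.add_one_le_exp (4 * l ^ 2)]
  have hnn : 0 ≤ ∑ x, w x * Real.exp (l * h x) :=
    Finset.sum_nonneg fun x _ => mul_nonneg (hw₀ x) (Real.exp_nonneg _)
  calc _ ≤ ∑ x : Fin N → X, Real.exp (-(l * (N * t))) * ∏ i, (w (x i) * Real.exp (l * h (x i))) := by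
        refine Finset.sum_le_sum fun x _ => ?_
        have hp : 0 ≤ ∏ i, w (x i) := Finset.prod_nonneg fun i _ => hw₀ _
        rw [Finset.prod_mul_distrib, ← Real.exp_sum, ← Finset.mul_sum, mul_left_comm,
          ← Real.exp_add, Set.indicator_apply]
        split_ifs with hx
        · refine le_mul_of_one_le_right hp (Real.one_le_exp ?_)
          rw [neg_add_eq_sub, ← mul_sub]
          exact mul_nonneg hl0 (sub_nonneg.mpr (le_of_lt hx))
        · positivity
    _ = Real.exp (-(l * (N * t))) * (∑ x, w x * Real.exp (l * h x)) ^ N := by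
        rw [← Finset.mul_sum, Fintype.sum_pow]
    _ ≤ Real.exp (-(l * (N * t))) * Real.exp (4 * l ^ 2) ^ N := by gcongr
    _ = Real.exp (-(N * t ^ 2 / 16)) := by
        rw [← Real.exp_nat_mul, ← Real.exp_add, hl]
        congr 1
        ring

/-- A Chernoff bound for the empirical mean of independent variables with values in `[-1, 1]`. -/
theorem sum_prod_indicator_abs_lt {w g : X → ℝ} (hw₀ : ∀ x, 0 ≤ w x) (hw : ∑ x, w x = 1)
    (hg : ∀ x, |g x| ≤ 1) {t : ℝ} (ht : 0 ≤ t) (ht' : t ≤ 4) {N : ℕ} (hN : 0 < N) :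
    ∑ x : Fin N → X, {x : Fin N → X | t < |1 / (N : ℝ) * ∑ i, g (x i) - ∑ y, w y * g y|}.indicator
      (fun x => ∏ i, w (x i)) x ≤ 2 * Real.exp (-(N * t ^ 2 / 16)) := by
  set m := ∑ y, w y * g y with hm
  have hm1 : |m| ≤ 1 := by
    calc |m| ≤ ∑ y, |w y * g y| := Finset.abs_sum_le_sum_abs _ _
      _ ≤ ∑ y, w y := Finset.sum_le_sum fun y _ => by
          rw [abs_mul, abs_of_nonneg (hw₀ y)]
          exact mul_le_of_le_one_right (hw₀ y) (hg y)
      _ = 1 := hw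
  have h₀ : ∑ x, w x * (g x - m) = 0 := by
    simp only [mul_sub, Finset.sum_sub_distrib, ← Finset.sum_mul, hw, ← hm]
    ring
  have h₀' : ∑ x, w x * (m - g x) = 0 := by
    simp only [mul_sub, Finset.sum_sub_distrib, ← Finset.sum_mul, hw, ← hm]
    ring
  have b : ∀ x, |g x - m| ≤ 2 := fun x => by
    linarith [abs_sub (g x) m, hg x]
  have b' : ∀ x, |m - g x| ≤ 2 := fun x => by rw [abs_sub_comm]; exact b x
  have e₁ := sum_prod_indicator_le_exp hw₀ hw h₀ b ht ht' N
  have e₂ := sum_prod_indicator_le_exp hw₀ hw h₀' b' ht ht' N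
  rw [two_mul]
  refine le_trans ?_ (add_le_add e₁ e₂)
  rw [← Finset.sum_add_distrib]
  refine Finset.sum_le_sum fun x _ => ?_
  have hp : 0 ≤ ∏ i, w (x i) := Finset.prod_nonneg fun i _ => hw₀ _
  have hN' : (0 : ℝ) < N := Nat.cast_pos.mpr hN
  simp only [Set.indicator_apply, Set.mem_ofPred_eq, Finset.sum_sub_distrib, Finset.sum_const,
    Finset.card_univ, Fintype.card_fin, nsmul_eq_mul]
  by_cases hx : t < |1 / (N : ℝ) * ∑ i, g (x i) - m|
  · rw [if_pos hx]
    have hS : (N : ℝ) * (1 / (N : ℝ) * ∑ i, g (x i)) = ∑ i, g (x i) := by field_simp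
    rcases lt_abs.mp hx with h | h
    · have : (N : ℝ) * t < ∑ i, g (x i) - N * m := by
        rw [← hS, ← mul_sub]
        exact mul_lt_mul_of_pos_left h hN'
      rw [if_pos this]
      split_ifs <;> linarith
    · have : (N : ℝ) * t < N * m - ∑ i, g (x i) := by
        rw [← hS, ← mul_sub]
        exact mul_lt_mul_of_pos_left (by linarith) hN'
      rw [if_pos this]
      split_ifs <;> linarith
  · rw [if_neg hx]
    split_ifs <;> linarith

end ProductDistribution

/-! ### The estimated ratio -/

/-- The summand `2xy / (x² k + y² l)` of the estimator. -/
noncomputable def ratio (k l x y : ℝ) : ℝ := 2 * x * y / (x ^ 2 * k + y ^ 2 * l)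

/-- AM-GM: the two terms of the denominator have product `(x y)²` because `k l = 1`. A vanishing
denominator is harmless, division by zero being zero. -/
theorem abs_ratio_le_one {k l : ℝ} (hk : 0 < k) (hkl : k * l = 1) (x y : ℝ) :
    |ratio k l x y| ≤ 1 := by
  have hl : 0 < l := by
    by_contra! h
    nlinarith
  have key : |2 * x * y| ≤ x ^ 2 * k + y ^ 2 * l := by
    have h1 : (x ^ 2 * k) * (y ^ 2 * l) = (x * y) ^ 2 := by linear_combination x ^ 2 * y ^ 2 * hkl
    apply abs_le_of_sq_le_sq
    · nlinarith [sq_nonneg (x ^ 2 * k - y ^ 2 * l)]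
    · positivity
  rw [ratio, abs_div, abs_of_nonneg (by positivity : 0 ≤ x ^ 2 * k + y ^ 2 * l)]
  exact div_le_one_of_le₀ key (by positivity)

/-- The ratio is stable under perturbations that are small compared to `(x, y)`. -/
theorem ratio_sub_sq_le {k l : ℝ} (hk : 0 < k) (hl : 0 < l) (hkl : k * l = 1) {x y : ℝ}
    (hxy : 0 < x ^ 2 * k + y ^ 2 * l) (u v : ℝ) :
    (ratio k l u v - ratio k l x y) ^ 2 ≤
      4 * ((u - x) ^ 2 * k + (v - y) ^ 2 * l) / (x ^ 2 * k + y ^ 2 * l) := by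
  set Q := x ^ 2 * k + y ^ 2 * l with hQ
  rcases (by positivity : 0 ≤ u ^ 2 * k + v ^ 2 * l).eq_or_lt with h | hR
  · have hu : u = 0 := by
      have : u ^ 2 * k = 0 := by nlinarith [mul_nonneg (sq_nonneg u) hk.le, mul_nonneg (sq_nonneg v) hl.le]
      simpa [hk.ne'] using this
    have hv : v = 0 := by
      have : v ^ 2 * l = 0 := by nlinarith [mul_nonneg (sq_nonneg u) hk.le, mul_nonneg (sq_nonneg v) hl.le]
      simpa [hl.ne'] using this
    subst hu hv
    -- At `u = v = 0` the ratio is `0` by convention, and the bound reads `ratio² ≤ 4`.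
    have h1 : 4 * ((0 - x) ^ 2 * k + (0 - y) ^ 2 * l) / Q = 4 := by
      rw [hQ] at hxy ⊢
      field_simp
      ring
    have h2 := abs_ratio_le_one hk hkl x y
    rw [h1]
    have h3 : ratio k l 0 0 = 0 := by simp [ratio]
    rw [h3, zero_sub, neg_sq, ← sq_abs]
    nlinarith [abs_nonneg (ratio k l x y)]
  · set R := u ^ 2 * k + v ^ 2 * l with hR'
    set D := (u - x) ^ 2 * k + (v - y) ^ 2 * l with hD
    -- In polar coordinates for `(x√k, y√l)` the ratio is `sin 2θ`, and this is `sin 2φ - sin 2θ = 2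
    -- sin(φ - θ) cos(φ + θ)`. Then `e2` bounds the sine by Cauchy–Schwarz, and `e3` says that the
    -- cosine is at most one in modulus.
    have e1 : ratio k l u v - ratio k l x y =
        2 * ((u * y - v * x) * (v * y * l - u * x * k)) / (R * Q) := by
      rw [ratio, ratio, ← hR', ← hQ, div_sub_div _ _ hR.ne' hxy.ne']
      congr 1
      rw [hR', hQ]
      ring
    have e2 : (u * y - v * x) ^ 2 ≤ D * R := by
      have : D * R - (u * y - v * x) ^ 2 = ((u - x) * u * k + (v - y) * v * l) ^ 2 := by
        rw [hD, hR']
        linear_combination (u * y - v * x) ^ 2 * hkl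
      nlinarith [sq_nonneg ((u - x) * u * k + (v - y) * v * l)]
    have e3 : (v * y * l - u * x * k) ^ 2 ≤ R * Q := by
      have : R * Q - (v * y * l - u * x * k) ^ 2 = k * l * (u * y + v * x) ^ 2 := by
        rw [hR', hQ]
        ring
      have : 0 ≤ k * l * (u * y + v * x) ^ 2 := by positivity
      linarith
    have e4 : 0 ≤ D := by positivity
    rw [e1, div_pow, div_le_div_iff₀ (by positivity) hxy]
    calc (2 * ((u * y - v * x) * (v * y * l - u * x * k))) ^ 2 * Q
        = 4 * ((u * y - v * x) ^ 2 * (v * y * l - u * x * k) ^ 2) * Q := by ring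
      _ ≤ 4 * ((D * R) * (R * Q)) * Q := by gcongr
      _ = 4 * D * (R * Q) ^ 2 := by ring

/-! ### Comparison of the label distributions -/

theorem purity_pos {n : ℕ} {ρ : Op n} (hρ : IsState ρ) : 0 < purity ρ := by
  have hH : ρ.conjTranspose = ρ := hρ.1.isHermitian
  have h0 : 0 ≤ (ρ * ρ).trace := by
    have := (Matrix.posSemidef_conjTranspose_mul_self ρ).trace_nonneg
    rwa [hH] at this
  have hre := (Complex.le_def.mp h0)
  refine lt_of_le_of_ne hre.1 fun h => ?_
  have hz : (ρ.conjTranspose * ρ).trace = 0 := by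
    rw [hH]
    exact Complex.ext h.symm hre.2.symm
  rw [Matrix.trace_conjTranspose_mul_self_eq_zero_iff] at hz
  have := hρ.2
  rw [hz, Matrix.trace_zero] at this
  exact zero_ne_one this

/-- The characteristic distribution `2⁻ⁿ tr(ρ P_a)² / tr ρ²`. -/
noncomputable def charDist {n : ℕ} (ρ : Op n) (a : Fin n → Fin 4) : ℝ :=
  expect ρ a ^ 2 / (2 ^ n * purity ρ)

theorem charDist_nonneg {n : ℕ} {ρ : Op n} (hρ : IsState ρ) (a : Fin n → Fin 4) :
    0 ≤ charDist ρ a :=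
  div_nonneg (sq_nonneg _) (mul_nonneg (by positivity) (purity_pos hρ).le)

theorem sum_charDist {n : ℕ} {ρ : Op n} (hρ : IsState ρ) : ∑ a, charDist ρ a = 1 := by
  simp only [charDist]
  rw [← Finset.sum_div, sum_expect_sq hρ.1.isHermitian]
  exact div_self (mul_pos (by positivity) (purity_pos hρ)).ne'

section Perturbation

variable {n : ℕ} {ρ ρ' : Op n} {τ : ℝ}

/-- Parseval for `ρ - ρ'`, whose Hilbert–Schmidt norm is at most its trace norm. -/
theorem sum_expect_sub_sq_le (hρ : IsState ρ) (hρ' : IsState ρ') (hτ : traceNorm (ρ - ρ') ≤ τ) :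
    ∑ a, (expect ρ a - expect ρ' a) ^ 2 ≤ 2 ^ n * τ ^ 2 := by
  have hH := hρ.1.isHermitian.sub hρ'.1.isHermitian
  simp only [← expect_sub]
  rw [sum_expect_sq hH]
  have h1 := purity_le_traceNorm_sq hH
  have h2 : traceNorm (ρ - ρ') ^ 2 ≤ τ ^ 2 := pow_le_pow_left₀ (traceNorm_nonneg _) hτ 2
  exact mul_le_mul_of_nonneg_left (h1.trans h2) (by positivity)

/-- Factor `u² - v²` and apply AM-GM weighted by `τ`: this trades an `ℓ¹` sum over all labels for
two `ℓ²` sums, which Parseval controls. The result is `2 ^ n * (τ/2 + τ³ + 4τ)`. -/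
theorem sum_abs_expect_sq_sub_le (hρ : IsState ρ) (hρ' : IsState ρ') (hp : purity ρ = 1)
    (hτ₀ : 0 < τ) (hτ₁ : τ ≤ 2 / 29) (hτ : traceNorm (ρ - ρ') ≤ τ) :
    ∑ a, |expect ρ a ^ 2 - expect ρ' a ^ 2| ≤ 2 ^ n * (5 * τ) := by
  have h1 := sum_expect_sub_sq_le hρ hρ' hτ
  have h2 := sum_expect_sq hρ.1.isHermitian
  rw [hp, mul_one] at h2
  have key : ∀ u v : ℝ, |u ^ 2 - v ^ 2| ≤ (1 / (2 * τ) + τ) * (u - v) ^ 2 + 4 * τ * u ^ 2 := by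
    intro u v
    have e : |u ^ 2 - v ^ 2| = |u - v| * |u + v| := by rw [← abs_mul]; congr 1; ring
    have e1 : |u - v| * |u + v| ≤ 1 / (2 * τ) * (u - v) ^ 2 + τ / 2 * (u + v) ^ 2 := by
      have h0 : 0 ≤ (|u - v| - τ * |u + v|) ^ 2 / (2 * τ) := by positivity
      have : (|u - v| - τ * |u + v|) ^ 2 / (2 * τ) = 1 / (2 * τ) * |u - v| ^ 2 +
          τ / 2 * |u + v| ^ 2 - |u - v| * |u + v| := by
        field_simp
        ring
      rw [this, sq_abs, sq_abs] at h0
      linarith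
    rw [e]
    -- The slack in `(u + v)² / 2 ≤ (u - v)² + 4u²` is `(3u - v)² / 2`.
    nlinarith [mul_nonneg hτ₀.le (sq_nonneg (3 * u - v))]
  calc _ ≤ ∑ a, ((1 / (2 * τ) + τ) * (expect ρ a - expect ρ' a) ^ 2 + 4 * τ * expect ρ a ^ 2) :=
        Finset.sum_le_sum fun a _ => key _ _
    _ = (1 / (2 * τ) + τ) * ∑ a, (expect ρ a - expect ρ' a) ^ 2 + 4 * τ * 2 ^ n := by
        rw [Finset.sum_add_distrib, ← Finset.mul_sum, ← Finset.mul_sum, h2]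
    _ ≤ (1 / (2 * τ) + τ) * (2 ^ n * τ ^ 2) + 4 * τ * 2 ^ n := by gcongr
    _ = 2 ^ n * (τ / 2 + τ ^ 3 + 4 * τ) := by field_simp
    _ ≤ _ := by
        gcongr
        nlinarith [mul_pos hτ₀ hτ₀]

theorem abs_one_sub_purity_le (hρ : IsState ρ) (hρ' : IsState ρ') (hp : purity ρ = 1)
    (hτ₀ : 0 < τ) (hτ₁ : τ ≤ 2 / 29) (hτ : traceNorm (ρ - ρ') ≤ τ) :
    |1 - purity ρ'| ≤ 5 * τ := by
  have h := sum_abs_expect_sq_sub_le hρ hρ' hp hτ₀ hτ₁ hτ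
  have h1 := (Finset.abs_sum_le_sum_abs (fun a => expect ρ a ^ 2 - expect ρ' a ^ 2)
    Finset.univ).trans h
  rw [Finset.sum_sub_distrib, sum_expect_sq hρ.1.isHermitian, sum_expect_sq hρ'.1.isHermitian, hp,
    ← mul_sub, abs_mul, abs_of_pos (by positivity : (0 : ℝ) < 2 ^ n)] at h1
  exact le_of_mul_le_mul_left h1 (by positivity)

/-- Pass from the Bell distribution of `ρ'` to that of `ρ` (cost `2τ`), which equals the squared
expectations over `2 ^ n`; replace these by those of `ρ'` (`5τ`); then normalize by the purity of
`ρ'` (`5τ`). -/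
theorem sum_abs_bellDist_sub_charDist_le (hρ : IsState ρ) (hρ' : IsState ρ') (hp : purity ρ = 1)
    (hb : ∀ a, 2 ^ n * bellDist ρ a = expect ρ a ^ 2)
    (hτ₀ : 0 < τ) (hτ₁ : τ ≤ 2 / 29) (hτ : traceNorm (ρ - ρ') ≤ τ) :
    ∑ a, |bellDist ρ' a - charDist ρ' a| ≤ 12 * τ := by
  have h1 := sum_abs_bellDist_sub_le hρ hρ'
  have h2 := sum_abs_expect_sq_sub_le hρ hρ' hp hτ₀ hτ₁ hτ
  have h3 := abs_one_sub_purity_le hρ hρ' hp hτ₀ hτ₁ hτ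
  have h4 := sum_charDist hρ'
  have hpos := purity_pos hρ'
  have h2n : (0 : ℝ) < 2 ^ n := by positivity
  have key : ∀ a, |bellDist ρ' a - charDist ρ' a| ≤ |bellDist ρ a - bellDist ρ' a| +
      |expect ρ a ^ 2 - expect ρ' a ^ 2| / 2 ^ n + charDist ρ' a * |1 - purity ρ'| := by
    intro a
    have e : bellDist ρ' a - charDist ρ' a = -(bellDist ρ a - bellDist ρ' a) +
        (expect ρ a ^ 2 - expect ρ' a ^ 2) / 2 ^ n - charDist ρ' a * (1 - purity ρ') := by
      rw [← hb, charDist]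
      field_simp
      ring
    rw [e]
    refine (abs_sub _ _).trans (add_le_add ((abs_add_le _ _).trans ?_) ?_)
    · rw [abs_neg, abs_div, abs_of_pos h2n]
    · rw [abs_mul, abs_of_nonneg (charDist_nonneg hρ' a)]
  calc _ ≤ ∑ a, (|bellDist ρ a - bellDist ρ' a| +
      |expect ρ a ^ 2 - expect ρ' a ^ 2| / 2 ^ n + charDist ρ' a * |1 - purity ρ'|) :=
        Finset.sum_le_sum fun a _ => key a
    _ = ∑ a, |bellDist ρ a - bellDist ρ' a| +
        (∑ a, |expect ρ a ^ 2 - expect ρ' a ^ 2|) / 2 ^ n + |1 - purity ρ'| := by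
        rw [Finset.sum_add_distrib, Finset.sum_add_distrib, ← Finset.sum_div, ← Finset.sum_mul, h4,
          one_mul]
    _ ≤ 2 * τ + 5 * τ + 5 * τ := by
        refine add_le_add (add_le_add (by linarith) ?_) h3
        rw [div_le_iff₀ h2n]
        linarith
    _ = 12 * τ := by ring

/-- Labels whose Pauli expectation falls below half the minimal nonzero value are unlikely. -/
theorem sum_bellDist_small_le (hn : 0 < n) (hρ : IsState ρ) (hρ' : IsState ρ')
    (hb : ∀ a, 2 ^ n * bellDist ρ a = expect ρ a ^ 2)
    (hgap : ∀ a, expect ρ a = 0 ∨ 1 / (n : ℝ) ≤ |expect ρ a|)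
    (hτ₀ : 0 < τ) (hτ₁ : τ ≤ 2 / 29) (hτ : traceNorm (ρ - ρ') ≤ τ) :
    ∑ a, (if |expect ρ' a| < 1 / (2 * n) then bellDist ρ' a else 0) ≤ 3 * τ := by
  have h1 := sum_abs_bellDist_sub_le hρ hρ'
  have h2 := sum_expect_sub_sq_le hρ hρ' hτ
  have h2n : (0 : ℝ) < 2 ^ n := by positivity
  have key : ∀ a, (if |expect ρ' a| < 1 / (2 * n) then bellDist ρ' a else 0) ≤
      |bellDist ρ a - bellDist ρ' a| + 4 * ((expect ρ a - expect ρ' a) ^ 2 / 2 ^ n) := by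
    intro a
    split_ifs with h
    -- If the expectation of `ρ` is nonzero, the gap makes it more than twice that of `ρ'`, so it is
    -- at most twice the difference; squaring gives the factor 4.
    · have hq : bellDist ρ a ≤ 4 * ((expect ρ a - expect ρ' a) ^ 2 / 2 ^ n) := by
        rw [← mul_div_assoc, le_div_iff₀ h2n, mul_comm, hb]
        rcases hgap a with h0 | h0
        · rw [h0]
          nlinarith [sq_nonneg (expect ρ' a)]
        · have e : 1 / (2 * (n : ℝ)) = 1 / (n : ℝ) / 2 := by field_simp
          have h3 : |expect ρ' a| < |expect ρ a| / 2 := by rw [e] at h; linarith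
          have h4 := abs_sub_abs_le_abs_sub (expect ρ a) (expect ρ' a)
          rw [← sq_abs (expect ρ a), ← sq_abs (expect ρ a - expect ρ' a)]
          nlinarith [abs_nonneg (expect ρ a), abs_nonneg (expect ρ' a)]
      have := neg_abs_le (bellDist ρ a - bellDist ρ' a)
      linarith
    · positivity
  calc _ ≤ ∑ a, (|bellDist ρ a - bellDist ρ' a| +
        4 * ((expect ρ a - expect ρ' a) ^ 2 / 2 ^ n)) := Finset.sum_le_sum fun a _ => key a
    _ = ∑ a, |bellDist ρ a - bellDist ρ' a| +
        4 * ((∑ a, (expect ρ a - expect ρ' a) ^ 2) / 2 ^ n) := by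
        rw [Finset.sum_add_distrib, ← Finset.mul_sum, Finset.sum_div]
    _ ≤ 2 * τ + 4 * τ ^ 2 := by
        refine add_le_add (by linarith) ?_
        refine mul_le_mul_of_nonneg_left ?_ (by norm_num)
        rw [div_le_iff₀ h2n]
        linarith
    _ ≤ 3 * τ := by nlinarith

end Perturbation

/-! ### The ideal estimator -/

theorem sqrt_div_mul_sqrt_div {A B : ℝ} (hA : 0 < A) (hB : 0 < B) :
    Real.sqrt (B / A) * Real.sqrt (A / B) = 1 := by
  rw [← Real.sqrt_mul (by positivity), div_mul_div_cancel₀ hA.ne', div_self hB.ne', Real.sqrt_one]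

/-- The target quantity is the mean of the exact ratios under the characteristic distribution. -/
theorem cosine_eq_sum {n : ℕ} {ρ σ : Op n} (hρ : IsState ρ) (hσ : IsState σ) :
    cosine ρ σ = ∑ a, (charDist ρ a + charDist σ a) / 2 *
      ratio (Real.sqrt (purity σ / purity ρ)) (Real.sqrt (purity ρ / purity σ))
        (expect ρ a) (expect σ a) := by
  have hA := purity_pos hρ
  have hB := purity_pos hσ
  set A := purity ρ
  set B := purity σ
  have hsA := Real.sqrt_pos.mpr hA
  have hsB := Real.sqrt_pos.mpr hB
  have h2n : (0 : ℝ) < 2 ^ n := by positivity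
  -- The mixture weight is proportional to the denominator of the ratio, so the two cancel. If both
  -- expectations vanish, both sides are zero.
  have key : ∀ a, (charDist ρ a + charDist σ a) / 2 * ratio (Real.sqrt (B / A)) (Real.sqrt (A / B))
      (expect ρ a) (expect σ a) = expect ρ a * expect σ a / (2 ^ n * Real.sqrt (A * B)) := by
    intro a
    generalize hr : expect ρ a = r
    generalize hs : expect σ a = s
    have e1 : charDist ρ a = r ^ 2 / (2 ^ n * Real.sqrt A ^ 2) := by
      rw [charDist, hr, Real.sq_sqrt hA.le]
    have e2 : charDist σ a = s ^ 2 / (2 ^ n * Real.sqrt B ^ 2) := by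
      rw [charDist, hs, Real.sq_sqrt hB.le]
    rw [e1, e2, ratio, Real.sqrt_mul hA.le, Real.sqrt_div hB.le, Real.sqrt_div hA.le]
    generalize Real.sqrt A = x at *
    generalize Real.sqrt B = y at *
    by_cases h0 : r = 0 ∧ s = 0
    · simp [h0.1, h0.2]
    · have hd : 0 < r ^ 2 * (y / x) + s ^ 2 * (x / y) := by
        rcases not_and_or.mp h0 with h | h
        · have : 0 < r ^ 2 := by positivity
          positivity
        · have : 0 < s ^ 2 := by positivity
          positivity
      have hd' : 0 < r ^ 2 * y ^ 2 + s ^ 2 * x ^ 2 := by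
        rcases not_and_or.mp h0 with h | h
        · have : 0 < r ^ 2 := by positivity
          positivity
        · have : 0 < s ^ 2 := by positivity
          positivity
      have e : r ^ 2 * (y / x) + s ^ 2 * (x / y) = (r ^ 2 * y ^ 2 + s ^ 2 * x ^ 2) / (x * y) := by
        field_simp
      rw [e]
      field_simp
      rw [mul_div_assoc, mul_comm (x ^ 2), div_self hd'.ne', mul_one]
  simp only [key]
  rw [← Finset.sum_div, sum_expect_mul hρ.1.isHermitian hσ.1.isHermitian, cosine,
    mul_div_mul_left _ _ h2n.ne']

theorem abs_cosine_le_one {n : ℕ} {ρ σ : Op n} (hρ : IsState ρ) (hσ : IsState σ) :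
    |cosine ρ σ| ≤ 1 := by
  have hA := purity_pos hρ
  have hB := purity_pos hσ
  rw [cosine_eq_sum hρ hσ]
  calc _ ≤ ∑ a, (charDist ρ a + charDist σ a) / 2 := by
        refine (Finset.abs_sum_le_sum_abs _ _).trans (Finset.sum_le_sum fun a _ => ?_)
        have h0 : 0 ≤ (charDist ρ a + charDist σ a) / 2 := by
          linarith [charDist_nonneg hρ a, charDist_nonneg hσ a]
        rw [abs_mul, abs_of_nonneg h0]
        exact mul_le_of_le_one_right h0 (abs_ratio_le_one (Real.sqrt_pos.mpr (by positivity))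
          (sqrt_div_mul_sqrt_div hA hB) _ _)
    _ = 1 := by
        rw [← Finset.sum_div, Finset.sum_add_distrib, sum_charDist hρ, sum_charDist hσ]
        norm_num

/-! ### Finite single-copy statistics -/

/-- The empirical mean of a sequence of signs. -/
noncomputable def signMean {N : ℕ} (x : Fin N → ℤˣ) : ℝ := (∑ j, ((x j : ℤ) : ℝ)) / N

theorem sum_pauliOutcomeProb {n : ℕ} {ρ : Op n} (hρ : IsState ρ) (a : Fin n → Fin 4) :
    ∑ s, pauliOutcomeProb ρ a s = 1 := by
  simp only [pauliOutcomeProb_eq hρ, UnitsInt.univ]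
  rw [Finset.sum_pair (by decide)]
  simp
  ring

theorem sum_prod_mul_signMean_sub_sq_le {n : ℕ} {ρ : Op n} (hρ : IsState ρ)
    (a : Fin n → Fin 4) {N : ℕ} (hN : 0 < N) :
    ∑ x : Fin N → ℤˣ, (∏ j, pauliOutcomeProb ρ a (x j)) * (signMean x - expect ρ a) ^ 2 ≤
      1 / N := by
  have hN' : (0 : ℝ) < N := Nat.cast_pos.mpr hN
  have h0 : ∑ s : ℤˣ, pauliOutcomeProb ρ a s * (((s : ℤ) : ℝ) - expect ρ a) = 0 := by
    simp only [pauliOutcomeProb_eq hρ, UnitsInt.univ]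
    rw [Finset.sum_pair (by decide)]
    simp
    ring
  have hv : ∑ s : ℤˣ, pauliOutcomeProb ρ a s * (((s : ℤ) : ℝ) - expect ρ a) ^ 2 =
      1 - expect ρ a ^ 2 := by
    simp only [pauliOutcomeProb_eq hρ, UnitsInt.univ]
    rw [Finset.sum_pair (by decide)]
    simp
    ring
  have h := sum_prod_mul_sum_sq (sum_pauliOutcomeProb hρ a) h0 N
  rw [hv] at h
  have e : ∀ x : Fin N → ℤˣ, (∏ j, pauliOutcomeProb ρ a (x j)) * (signMean x - expect ρ a) ^ 2 =
      (∏ j, pauliOutcomeProb ρ a (x j)) * (∑ j, (((x j : ℤ) : ℝ) - expect ρ a)) ^ 2 / N ^ 2 := by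
    intro x
    rw [Finset.sum_sub_distrib, Finset.sum_const, Finset.card_univ, Fintype.card_fin, nsmul_eq_mul,
      signMean]
    field_simp
  simp only [e]
  rw [← Finset.sum_div, h, div_le_div_iff₀ (by positivity) hN']
  nlinarith [sq_nonneg (expect ρ a), mul_pos hN' hN']

/-- Nonnegativity of the variance. It turns the second-moment bound on the ratio error into a bound
on its bias. -/
theorem sum_mul_abs_le_of_sum_mul_sq_le {X : Type*} [Fintype X] {w d : X → ℝ}
    (hw₀ : ∀ x, 0 ≤ w x) (hw : ∑ x, w x = 1) {t : ℝ} (ht : 0 ≤ t)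
    (h : ∑ x, w x * d x ^ 2 ≤ t ^ 2) : |∑ x, w x * d x| ≤ t := by
  refine abs_le_of_sq_le_sq (le_trans ?_ h) ht
  set m := ∑ x, w x * d x with hm
  have h1 : 0 ≤ ∑ x, w x * (d x - m) ^ 2 :=
    Finset.sum_nonneg fun x _ => mul_nonneg (hw₀ x) (sq_nonneg _)
  have h2 : ∑ x, w x * (d x - m) ^ 2 = ∑ x, w x * d x ^ 2 - m ^ 2 := by
    calc _ = ∑ x, (w x * d x ^ 2 - 2 * m * (w x * d x) + m ^ 2 * w x) :=
          Finset.sum_congr rfl fun x _ => by ring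
      _ = _ := by
          rw [Finset.sum_add_distrib, Finset.sum_sub_distrib, ← Finset.mul_sum, ← Finset.mul_sum,
            hw, ← hm]
          ring
  linarith

/-! ### The sampling model -/

/-- The outcomes of one round of the protocol: a label and two sequences of signs. -/
abbrev Round (n N₂ : ℕ) : Type := (Fin n → Fin 4) × (Fin N₂ → ℤˣ) × (Fin N₂ → ℤˣ)

section Rounds

variable {n N₂ : ℕ} {ρ σ : Op n}

/-- The probability of the label `a`. -/
noncomputable def labelProb (ρ σ : Op n) (a : Fin n → Fin 4) : ℝ := (bellDist ρ a + bellDist σ a) / 2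

/-- The probability of a round. -/
noncomputable def roundProb (ρ σ : Op n) (x : Round n N₂) : ℝ :=
  labelProb ρ σ x.1 * ((∏ j, pauliOutcomeProb ρ x.1 (x.2.1 j)) *
    ∏ j, pauliOutcomeProb σ x.1 (x.2.2 j))

/-- The exact or estimated ratio for the purities of `ρ` and `σ`. -/
noncomputable def stateRatio (ρ σ : Op n) (x y : ℝ) : ℝ :=
  ratio (Real.sqrt (purity σ / purity ρ)) (Real.sqrt (purity ρ / purity σ)) x y

/-- The contribution of a round to the estimator. -/
noncomputable def roundValue (ρ σ : Op n) (x : Round n N₂) : ℝ :=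
  stateRatio ρ σ (signMean x.2.1) (signMean x.2.2)

theorem abs_stateRatio_le_one (hρ : IsState ρ) (hσ : IsState σ) (x y : ℝ) :
    |stateRatio ρ σ x y| ≤ 1 :=
  abs_ratio_le_one (Real.sqrt_pos.mpr (div_pos (purity_pos hσ) (purity_pos hρ)))
    (sqrt_div_mul_sqrt_div (purity_pos hρ) (purity_pos hσ)) x y

theorem labelProb_nonneg (hρ : IsState ρ) (hσ : IsState σ) (a : Fin n → Fin 4) :
    0 ≤ labelProb ρ σ a := by
  have := bellDist_nonneg hρ.1 a
  have := bellDist_nonneg hσ.1 a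
  unfold labelProb
  linarith

theorem sum_labelProb (hρ : IsState ρ) (hσ : IsState σ) : ∑ a, labelProb ρ σ a = 1 := by
  simp only [labelProb]
  rw [← Finset.sum_div, Finset.sum_add_distrib, sum_bellDist hρ, sum_bellDist hσ]
  norm_num

theorem roundProb_nonneg (hρ : IsState ρ) (hσ : IsState σ) (x : Round n N₂) :
    0 ≤ roundProb ρ σ x :=
  mul_nonneg (labelProb_nonneg hρ hσ _)
    (mul_nonneg (Finset.prod_nonneg fun _ _ => pauliOutcomeProb_nonneg hρ.1 _ _)
      (Finset.prod_nonneg fun _ _ => pauliOutcomeProb_nonneg hσ.1 _ _))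

/-- The joint probability of the single-copy outcomes, given the label. -/
noncomputable def outcomesProb (ρ σ : Op n) (a : Fin n → Fin 4)
    (y : (Fin N₂ → ℤˣ) × (Fin N₂ → ℤˣ)) : ℝ :=
  (∏ j, pauliOutcomeProb ρ a (y.1 j)) * ∏ j, pauliOutcomeProb σ a (y.2 j)

theorem outcomesProb_nonneg (hρ : IsState ρ) (hσ : IsState σ) (a : Fin n → Fin 4)
    (y : (Fin N₂ → ℤˣ) × (Fin N₂ → ℤˣ)) : 0 ≤ outcomesProb ρ σ a y :=
  mul_nonneg (Finset.prod_nonneg fun _ _ => pauliOutcomeProb_nonneg hρ.1 _ _)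
    (Finset.prod_nonneg fun _ _ => pauliOutcomeProb_nonneg hσ.1 _ _)

theorem sum_outcomesProb (hρ : IsState ρ) (hσ : IsState σ) (a : Fin n → Fin 4) :
    ∑ y : (Fin N₂ → ℤˣ) × (Fin N₂ → ℤˣ), outcomesProb ρ σ a y = 1 := by
  simp only [outcomesProb, Fintype.sum_prod_type, ← Finset.mul_sum]
  rw [← Finset.sum_mul, sum_prod_eq_one (sum_pauliOutcomeProb hρ a),
    sum_prod_eq_one (sum_pauliOutcomeProb hσ a), one_mul]

theorem sum_roundProb (hρ : IsState ρ) (hσ : IsState σ) :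
    ∑ x : Round n N₂, roundProb ρ σ x = 1 := by
  rw [Fintype.sum_prod_type]
  have : ∀ a, ∑ y : (Fin N₂ → ℤˣ) × (Fin N₂ → ℤˣ), roundProb ρ σ (a, y) = labelProb ρ σ a := by
    intro a
    have h := sum_outcomesProb (N₂ := N₂) hρ hσ a
    simp only [outcomesProb] at h
    simp only [roundProb, ← Finset.mul_sum, h, mul_one]
  simp only [this, sum_labelProb hρ hσ]

/-- The conditional mean of the estimated ratio is close to the exact ratio when one of the two
Pauli expectations is not too small. -/
theorem abs_sum_outcomesProb_mul_sub_le (hn : 0 < n) (hN : 0 < N₂) {τ : ℝ} (hτ : 0 < τ)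
    (hN₂ : 128 * (n : ℝ) ^ 2 / τ ^ 2 ≤ N₂) (hρ : IsState ρ) (hσ : IsState σ)
    (hA₁ : 1 / 2 ≤ purity ρ) (hA₂ : purity ρ ≤ 2) (hB₁ : 1 / 2 ≤ purity σ) (hB₂ : purity σ ≤ 2)
    (a : Fin n → Fin 4)
    (ha : 1 / (2 * (n : ℝ)) ≤ |expect ρ a| ∨ 1 / (2 * (n : ℝ)) ≤ |expect σ a|) :
    |∑ y : (Fin N₂ → ℤˣ) × (Fin N₂ → ℤˣ), outcomesProb ρ σ a y *
      (stateRatio ρ σ (signMean y.1) (signMean y.2) -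
        stateRatio ρ σ (expect ρ a) (expect σ a))| ≤ τ := by
  have hA : 0 < purity ρ := by linarith
  have hB : 0 < purity σ := by linarith
  have hn' : (0 : ℝ) < n := Nat.cast_pos.mpr hn
  have hN' : (0 : ℝ) < N₂ := Nat.cast_pos.mpr hN
  have bnd : ∀ {A B : ℝ}, 1 / 2 ≤ A → A ≤ 2 → 1 / 2 ≤ B → B ≤ 2 →
      1 / 2 ≤ Real.sqrt (B / A) ∧ Real.sqrt (B / A) ≤ 2 := by
    intro A B h1 h2 h3 h4
    have hA : 0 < A := by linarith
    constructor
    · apply Real.le_sqrt_of_sq_le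
      rw [le_div_iff₀ hA]
      linarith
    · rw [Real.sqrt_le_left (by norm_num), div_le_iff₀ hA]
      linarith
  obtain ⟨hk₁, hk₂⟩ := bnd hA₁ hA₂ hB₁ hB₂
  obtain ⟨hl₁, hl₂⟩ := bnd hB₁ hB₂ hA₁ hA₂
  have hkl := sqrt_div_mul_sqrt_div hA hB
  unfold stateRatio
  generalize Real.sqrt (purity σ / purity ρ) = k at *
  generalize Real.sqrt (purity ρ / purity σ) = l at *
  have hk : 0 < k := by linarith
  have hl : 0 < l := by linarith
  have hvρ := sum_prod_mul_signMean_sub_sq_le hρ a hN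
  have hvσ := sum_prod_mul_signMean_sub_sq_le hσ a hN
  set r := expect ρ a
  set s := expect σ a
  -- One expectation is at least `1/(2n)` in modulus and its weight `k` or `l` is at least `1/2`.
  have hQ : 1 / (8 * (n : ℝ) ^ 2) ≤ r ^ 2 * k + s ^ 2 * l := by
    have e : 1 / (8 * (n : ℝ) ^ 2) = (1 / (2 * (n : ℝ))) ^ 2 * (1 / 2) := by
      field_simp
      norm_num
    rw [e]
    rcases ha with h | h
    · have h1 : (1 / (2 * (n : ℝ))) ^ 2 ≤ r ^ 2 := by
        rw [← sq_abs r]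
        exact pow_le_pow_left₀ (by positivity) h 2
      calc _ ≤ r ^ 2 * k := mul_le_mul h1 hk₁ (by norm_num) (sq_nonneg _)
        _ ≤ _ := le_add_of_nonneg_right (by positivity)
    · have h1 : (1 / (2 * (n : ℝ))) ^ 2 ≤ s ^ 2 := by
        rw [← sq_abs s]
        exact pow_le_pow_left₀ (by positivity) h 2
      calc _ ≤ s ^ 2 * l := mul_le_mul h1 hl₁ (by norm_num) (sq_nonneg _)
        _ ≤ _ := le_add_of_nonneg_left (by positivity)
  have hQ0 : 0 < r ^ 2 * k + s ^ 2 * l := lt_of_lt_of_le (by positivity) hQ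
  refine sum_mul_abs_le_of_sum_mul_sq_le (fun y => outcomesProb_nonneg hρ hσ a y)
    (sum_outcomesProb hρ hσ a) hτ.le ?_
  set p : (Fin N₂ → ℤˣ) → ℝ := fun x => ∏ j, pauliOutcomeProb ρ a (x j) with hp
  set q : (Fin N₂ → ℤˣ) → ℝ := fun x => ∏ j, pauliOutcomeProb σ a (x j) with hq
  have hp1 : ∑ x, p x = 1 := sum_prod_eq_one (sum_pauliOutcomeProb hρ a) N₂
  have hq1 : ∑ x, q x = 1 := sum_prod_eq_one (sum_pauliOutcomeProb hσ a) N₂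
  calc ∑ y : (Fin N₂ → ℤˣ) × (Fin N₂ → ℤˣ), outcomesProb ρ σ a y *
        (ratio k l (signMean y.1) (signMean y.2) - ratio k l r s) ^ 2
      ≤ ∑ y : (Fin N₂ → ℤˣ) × (Fin N₂ → ℤˣ), p y.1 * q y.2 *
          -- The factor is `64 n² = 4 * 2 * 8 n²`: stability constant, bound on `k` and `l`, inverse
          -- of the lower bound on the denominator. Two variances of at most `1 / N₂` then give `128
          -- n² / N₂`.
          (128 * (n : ℝ) ^ 2 * (1 / 2) * ((signMean y.1 - r) ^ 2 + (signMean y.2 - s) ^ 2)) := by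
        refine Finset.sum_le_sum fun y _ =>
          mul_le_mul_of_nonneg_left ?_ (outcomesProb_nonneg hρ hσ a y)
        refine (ratio_sub_sq_le hk hl hkl hQ0 _ _).trans ?_
        rw [div_le_iff₀ hQ0]
        calc 4 * ((signMean y.1 - r) ^ 2 * k + (signMean y.2 - s) ^ 2 * l)
            ≤ 4 * ((signMean y.1 - r) ^ 2 * 2 + (signMean y.2 - s) ^ 2 * 2) := by gcongr
          _ = 128 * (n : ℝ) ^ 2 * (1 / 2) * ((signMean y.1 - r) ^ 2 + (signMean y.2 - s) ^ 2) *
              (1 / (8 * (n : ℝ) ^ 2)) := by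
              field_simp
              ring
          _ ≤ _ := by gcongr
    _ = 128 * (n : ℝ) ^ 2 * (1 / 2) *
          (∑ x, p x * (signMean x - r) ^ 2 + ∑ x, q x * (signMean x - s) ^ 2) := by
        have e : ∀ x y, p x * q y *
            (128 * (n : ℝ) ^ 2 * (1 / 2) * ((signMean x - r) ^ 2 + (signMean y - s) ^ 2)) =
            128 * (n : ℝ) ^ 2 * (1 / 2) * (p x * (signMean x - r) ^ 2 * q y +
              p x * (q y * (signMean y - s) ^ 2)) := fun x y => by ring
        simp only [Fintype.sum_prod_type, e, ← Finset.mul_sum, Finset.sum_add_distrib, hq1, mul_one]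
        rw [← Finset.sum_mul, hp1, one_mul]
    _ ≤ 128 * (n : ℝ) ^ 2 * (1 / 2) * (1 / N₂ + 1 / N₂) := by gcongr
    _ = 128 * (n : ℝ) ^ 2 / N₂ := by ring
    _ ≤ τ ^ 2 := by
        rw [div_le_iff₀ hN']
        rw [div_le_iff₀ (by positivity)] at hN₂
        linarith

/-- Conditioning on the label separates the exact ratio from the bias caused by finitely many
single-copy measurements. -/
theorem sum_roundProb_mul_roundValue (hρ : IsState ρ) (hσ : IsState σ) :
    ∑ x : Round n N₂, roundProb ρ σ x * roundValue ρ σ x =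
      ∑ a, labelProb ρ σ a * (stateRatio ρ σ (expect ρ a) (expect σ a) +
        ∑ y : (Fin N₂ → ℤˣ) × (Fin N₂ → ℤˣ), outcomesProb ρ σ a y *
          (stateRatio ρ σ (signMean y.1) (signMean y.2) -
            stateRatio ρ σ (expect ρ a) (expect σ a))) := by
  rw [Fintype.sum_prod_type]
  refine Finset.sum_congr rfl fun a _ => ?_
  simp only [mul_sub, Finset.sum_sub_distrib, ← Finset.sum_mul, sum_outcomesProb hρ hσ, one_mul,
    add_sub_cancel, Finset.mul_sum]
  refine Finset.sum_congr rfl fun y _ => ?_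
  rw [roundProb, roundValue, outcomesProb, mul_assoc]

/-- The mean of the estimator is close to the target quantity. -/
theorem abs_mean_sub_cosine_le (hn : 0 < n) (hN : 0 < N₂) {τ : ℝ} (hτ : 0 < τ)
    (hτ₁ : τ ≤ 2 / 29) (hN₂ : 128 * (n : ℝ) ^ 2 / τ ^ 2 ≤ N₂) {ρ₀ σ₀ : Op n} (hρ₀ : ρ₀ ∈ CW n)
    (hσ₀ : σ₀ ∈ CW n) (hρ : IsState ρ) (hσ : IsState σ) (hρτ : traceNorm (ρ₀ - ρ) ≤ τ)
    (hστ : traceNorm (σ₀ - σ) ≤ τ) :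
    |∑ x : Round n N₂, roundProb ρ σ x * roundValue ρ σ x - cosine ρ σ| ≤ 28 * τ := by
  obtain ⟨hsρ, hpρ, hbρ, hgρ⟩ := CW.properties hn hρ₀
  obtain ⟨hsσ, hpσ, hbσ, hgσ⟩ := CW.properties hn hσ₀
  have hAρ := abs_le.mp (abs_one_sub_purity_le hsρ hρ hpρ hτ hτ₁ hρτ)
  have hAσ := abs_le.mp (abs_one_sub_purity_le hsσ hσ hpσ hτ hτ₁ hστ)
  have hdρ := sum_abs_bellDist_sub_charDist_le hsρ hρ hpρ hbρ hτ hτ₁ hρτ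
  have hdσ := sum_abs_bellDist_sub_charDist_le hsσ hσ hpσ hbσ hτ hτ₁ hστ
  have hmρ := sum_bellDist_small_le hn hsρ hρ hbρ hgρ hτ hτ₁ hρτ
  have hmσ := sum_bellDist_small_le hn hsσ hσ hbσ hgσ hτ hτ₁ hστ
  rw [sum_roundProb_mul_roundValue hρ hσ, cosine_eq_sum hρ hσ, ← Finset.sum_sub_distrib]
  set err : (Fin n → Fin 4) → ℝ := fun a =>
    ∑ y : (Fin N₂ → ℤˣ) × (Fin N₂ → ℤˣ), outcomesProb ρ σ a y *
      (stateRatio ρ σ (signMean y.1) (signMean y.2) -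
        stateRatio ρ σ (expect ρ a) (expect σ a)) with herr
  have herr2 : ∀ a, |err a| ≤ 2 := by
    intro a
    calc |err a| ≤ ∑ y : (Fin N₂ → ℤˣ) × (Fin N₂ → ℤˣ), outcomesProb ρ σ a y * 2 := by
          refine (Finset.abs_sum_le_sum_abs _ _).trans (Finset.sum_le_sum fun y _ => ?_)
          rw [abs_mul, abs_of_nonneg (outcomesProb_nonneg hρ hσ a y)]
          refine mul_le_mul_of_nonneg_left ?_ (outcomesProb_nonneg hρ hσ a y)
          have h1 := abs_stateRatio_le_one hρ hσ (signMean y.1) (signMean y.2)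
          have h2 := abs_stateRatio_le_one hρ hσ (expect ρ a) (expect σ a)
          have h3 := abs_sub (stateRatio ρ σ (signMean y.1) (signMean y.2))
            (stateRatio ρ σ (expect ρ a) (expect σ a))
          linarith
      _ = 2 := by rw [← Finset.sum_mul, sum_outcomesProb hρ hσ, one_mul]
  -- The three terms are the bias on good labels, the mass of bad labels, and the mismatch of label
  -- distributions. A label is bad only if both expectations are small, so the trivial bias bound 2
  -- times its probability is covered by the two small masses.
  have key : ∀ a, |labelProb ρ σ a * (stateRatio ρ σ (expect ρ a) (expect σ a) + err a) -
      (charDist ρ a + charDist σ a) / 2 * stateRatio ρ σ (expect ρ a) (expect σ a)| ≤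
      labelProb ρ σ a * τ +
        ((if |expect ρ a| < 1 / (2 * n) then bellDist ρ a else 0) +
          (if |expect σ a| < 1 / (2 * n) then bellDist σ a else 0)) +
        (|bellDist ρ a - charDist ρ a| + |bellDist σ a - charDist σ a|) / 2 := by
    intro a
    have hL := labelProb_nonneg hρ hσ a
    have hqρ := bellDist_nonneg hρ.1 a
    have hqσ := bellDist_nonneg hσ.1 a
    have hg := abs_stateRatio_le_one hρ hσ (expect ρ a) (expect σ a)
    have e1 : |labelProb ρ σ a * err a| ≤ labelProb ρ σ a * τ +
        ((if |expect ρ a| < 1 / (2 * n) then bellDist ρ a else 0) +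
          (if |expect σ a| < 1 / (2 * n) then bellDist σ a else 0)) := by
      rw [abs_mul, abs_of_nonneg hL]
      have hnn : 0 ≤ labelProb ρ σ a * τ := mul_nonneg hL hτ.le
      by_cases hs : |expect ρ a| < 1 / (2 * n) ∧ |expect σ a| < 1 / (2 * n)
      · rw [if_pos hs.1, if_pos hs.2]
        have h1 := mul_le_mul_of_nonneg_left (herr2 a) hL
        have h2 : labelProb ρ σ a * 2 = bellDist ρ a + bellDist σ a := by
          rw [labelProb]
          ring
        linarith
      · have hs' : 1 / (2 * (n : ℝ)) ≤ |expect ρ a| ∨ 1 / (2 * (n : ℝ)) ≤ |expect σ a| := by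
          rw [not_and_or, not_lt, not_lt] at hs
          exact hs
        -- Both purities lie in `[1/2, 2]`, being within `5τ ≤ 10/29` of one.
        have h1 := abs_sum_outcomesProb_mul_sub_le hn hN hτ hN₂ hρ hσ (by linarith) (by linarith)
          (by linarith) (by linarith) a hs'
        have h2 := mul_le_mul_of_nonneg_left h1 hL
        refine h2.trans (le_add_of_nonneg_right (add_nonneg ?_ ?_))
        all_goals split_ifs <;> first | assumption | exact le_rfl
    have e2 : |(labelProb ρ σ a - (charDist ρ a + charDist σ a) / 2) *
        stateRatio ρ σ (expect ρ a) (expect σ a)| ≤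
        (|bellDist ρ a - charDist ρ a| + |bellDist σ a - charDist σ a|) / 2 := by
      rw [abs_mul]
      refine (mul_le_of_le_one_right (abs_nonneg _) hg).trans ?_
      rw [show labelProb ρ σ a - (charDist ρ a + charDist σ a) / 2 =
        ((bellDist ρ a - charDist ρ a) + (bellDist σ a - charDist σ a)) / 2 by
          rw [labelProb]; ring, abs_div, abs_of_pos (two_pos : (0 : ℝ) < 2)]
      exact div_le_div_of_nonneg_right (abs_add_le _ _) two_pos.le
    calc _ = |labelProb ρ σ a * err a + (labelProb ρ σ a - (charDist ρ a + charDist σ a) / 2) *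
        stateRatio ρ σ (expect ρ a) (expect σ a)| := by
          congr 1
          ring
      _ ≤ _ := (abs_add_le _ _).trans (add_le_add e1 e2)
  refine (Finset.abs_sum_le_sum_abs _ _).trans ((Finset.sum_le_sum fun a _ => key a).trans ?_)
  rw [Finset.sum_add_distrib, Finset.sum_add_distrib, Finset.sum_add_distrib, ← Finset.sum_mul,
    ← Finset.sum_div, Finset.sum_add_distrib, sum_labelProb hρ hσ]
  -- The total is `τ + (3τ + 3τ) + (12τ + 12τ) / 2 = 19τ`, well within `28τ`.
  linarith

end Rounds

/-- Transcripts are sequences of rounds. -/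
def transcriptRounds (n N₁ N₂ : ℕ) : Transcript n N₁ N₂ ≃ (Fin N₁ → Round n N₂) where
  toFun ω i := (ω.label i, ω.alice i, ω.bob i)
  invFun x := ⟨fun i => (x i).1, fun i => (x i).2.1, fun i => (x i).2.2⟩
  left_inv _ := rfl
  right_inv _ := rfl

theorem transcriptProb_eq_prod {n N₁ N₂ : ℕ} (ρ σ : Op n) (ω : Transcript n N₁ N₂) :
    transcriptProb ρ σ ω = ∏ i, roundProb ρ σ (transcriptRounds n N₁ N₂ ω i) := rfl

theorem estimator_eq_sum {n N₁ N₂ : ℕ} (ρ σ : Op n) (ω : Transcript n N₁ N₂) :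
    estimator ρ σ ω = 1 / (N₁ : ℝ) * ∑ i, roundValue ρ σ (transcriptRounds n N₁ N₂ ω i) := rfl

theorem abs_estimator_le_one {n N₁ N₂ : ℕ} (hN₁ : 0 < N₁) {ρ σ : Op n} (hρ : IsState ρ)
    (hσ : IsState σ) (ω : Transcript n N₁ N₂) : |estimator ρ σ ω| ≤ 1 := by
  have hN' : (0 : ℝ) < N₁ := Nat.cast_pos.mpr hN₁
  rw [estimator_eq_sum, abs_mul, abs_of_pos (by positivity : 0 < 1 / (N₁ : ℝ)), one_div,
    inv_mul_le_iff₀ hN', mul_one]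
  refine (Finset.abs_sum_le_sum_abs _ _).trans
    ((Finset.sum_le_sum fun i _ => abs_stateRatio_le_one hρ hσ _ _).trans ?_)
  simp

/-- The estimator concentrates around its mean. -/
theorem prob_abs_estimator_sub_le {n N₁ N₂ : ℕ} (hN₁ : 0 < N₁) {ρ σ : Op n} (hρ : IsState ρ)
    (hσ : IsState σ) {c t b : ℝ} (ht : 0 ≤ t) (ht' : t ≤ 4)
    (hc : |∑ x : Round n N₂, roundProb ρ σ x * roundValue ρ σ x - c| ≤ b) :
    prob ρ σ N₁ N₂ {ω | b + t < |estimator ρ σ ω - c|} ≤ 2 * Real.exp (-(N₁ * t ^ 2 / 16)) := by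
  refine le_trans ?_ (sum_prod_indicator_abs_lt (X := Round n N₂) (roundProb_nonneg hρ hσ)
    (sum_roundProb hρ hσ) (g := roundValue ρ σ) (fun x => abs_stateRatio_le_one hρ hσ _ _)
    ht ht' hN₁)
  rw [prob, ← (transcriptRounds n N₁ N₂).sum_comp]
  refine Finset.sum_le_sum fun ω _ => ?_
  simp only [Set.indicator_apply, Set.mem_ofPred_eq, transcriptProb_eq_prod, estimator_eq_sum]
  have hnn : 0 ≤ ∏ i, roundProb ρ σ (transcriptRounds n N₁ N₂ ω i) :=
    Finset.prod_nonneg fun i _ => roundProb_nonneg hρ hσ _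
  split_ifs with h1 h2 h2
  · exact le_rfl
  · exfalso
    have := abs_sub_le (1 / (N₁ : ℝ) * ∑ i, roundValue ρ σ (transcriptRounds n N₁ N₂ ω i))
      (∑ x : Round n N₂, roundProb ρ σ x * roundValue ρ σ x) c
    linarith
  · exact hnn
  · exact le_rfl

theorem ceil_add_one_le {x y : ℝ} (hx : 0 ≤ x) (hxy : x + 2 ≤ y) : ((⌈x⌉₊ + 1 : ℕ) : ℝ) ≤ y := by
  have := (Nat.ceil_lt_add_one hx).le
  push_cast
  linarith

end RDIPE

theorem mainTheorem4 (ρ σ : ∀ n : ℕ, RDIPE.Op n)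
    (hρ : ∀ n : ℕ, 0 < n → ρ n ∈ RDIPE.CW n) (hσ : ∀ n : ℕ, 0 < n → σ n ∈ RDIPE.CW n) :
    ∃ N₁ N₂ : ℕ → ℝ → ℝ → ℕ,
      RDIPE.IsPolyBounded N₁ ∧ RDIPE.IsPolyBounded N₂ ∧
      ∀ (n : ℕ) (τ δ : ℝ), 0 < n → 0 < τ → 0 < δ →
        0 < N₁ n τ δ ∧ 0 < N₂ n τ δ ∧
        ∀ ρ' σ' : ∀ m : ℕ, RDIPE.Op m,
          (∀ m : ℕ, 0 < m → RDIPE.IsState (ρ' m) ∧ RDIPE.traceNorm (ρ m - ρ' m) ≤ τ) →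
          (∀ m : ℕ, 0 < m → RDIPE.IsState (σ' m) ∧ RDIPE.traceNorm (σ m - σ' m) ≤ τ) →
          RDIPE.prob (ρ' n) (σ' n) (N₁ n τ δ) (N₂ n τ δ)
            {ω | 29 * τ < |RDIPE.estimator (ρ' n) (σ' n) ω - RDIPE.cosine (ρ' n) (σ' n)|}
            < Real.exp (-δ) := by
  -- The choice of `N₁` makes the Chernoff exponent at least `δ + 1`; `N₂` makes the conditional
  -- bias at most `τ`. Adding one keeps both positive, and rounding up accounts for the `+ 2` in the
  -- polynomials.
  refine ⟨fun _ τ δ => ⌈16 * (δ + 1) / τ ^ 2⌉₊ + 1, fun n τ _ => ⌈128 * (n : ℝ) ^ 2 / τ ^ 2⌉₊ + 1,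
    ⟨MvPolynomial.C 16 * (MvPolynomial.X 2 + 1) * MvPolynomial.X 1 ^ 2 + 2, ?_⟩,
    ⟨MvPolynomial.C 128 * MvPolynomial.X 0 ^ 2 * MvPolynomial.X 1 ^ 2 + 2, ?_⟩, ?_⟩
  · intro n τ δ _ hτ hδ
    refine RDIPE.ceil_add_one_le (by positivity) (le_of_eq ?_)
    simp [div_eq_mul_inv]
  · intro n τ δ _ hτ _
    refine RDIPE.ceil_add_one_le (by positivity) (le_of_eq ?_)
    simp [div_eq_mul_inv]
  · intro n τ δ hn hτ hδ
    refine ⟨Nat.succ_pos _, Nat.succ_pos _, fun ρ' σ' hρ' hσ' => ?_⟩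
    obtain ⟨hsρ, hρτ⟩ := hρ' n hn
    obtain ⟨hsσ, hστ⟩ := hσ' n hn
    set N₁ : ℕ := ⌈16 * (δ + 1) / τ ^ 2⌉₊ + 1 with hN₁
    set N₂ : ℕ := ⌈128 * (n : ℝ) ^ 2 / τ ^ 2⌉₊ + 1 with hN₂
    rcases le_or_gt τ (2 / 29) with hτ₁ | hτ₁
    · have hmean := RDIPE.abs_mean_sub_cosine_le hn (Nat.succ_pos _) hτ hτ₁
        (N₂ := N₂) ((Nat.le_ceil _).trans (by rw [hN₂]; push_cast; linarith)) (hρ n hn) (hσ n hn)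
        hsρ hsσ hρτ hστ
      have h := RDIPE.prob_abs_estimator_sub_le (N₁ := N₁) (Nat.succ_pos _) hsρ hsσ hτ.le
        (by linarith) hmean
      rw [show 28 * τ + τ = 29 * τ by ring] at h
      refine h.trans_lt ?_
      have h1 : δ + 1 ≤ N₁ * τ ^ 2 / 16 := by
        have : 16 * (δ + 1) / τ ^ 2 ≤ N₁ :=
          (Nat.le_ceil _).trans (by rw [hN₁]; push_cast; linarith)
        rw [div_le_iff₀ (by positivity)] at this
        linarith
      -- The extra unit in the exponent absorbs the factor 2 of the two-sided tail and makes the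
      -- inequality strict.
      have h2 : (2 : ℝ) < Real.exp 1 := by linarith [Real.exp_one_gt_d9]
      calc 2 * Real.exp (-(N₁ * τ ^ 2 / 16)) ≤ 2 * Real.exp (-(δ + 1)) := by gcongr
        _ < Real.exp 1 * Real.exp (-(δ + 1)) := by gcongr
        _ = Real.exp (-δ) := by
            rw [← Real.exp_add]
            congr 1
            ring
    -- Here `29τ > 2`, while two numbers in `[-1, 1]` differ by at most 2.
    · have hempty : {ω : RDIPE.Transcript n N₁ N₂ | 29 * τ <
          |RDIPE.estimator (ρ' n) (σ' n) ω - RDIPE.cosine (ρ' n) (σ' n)|} = ∅ := by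
        refine Set.eq_empty_of_forall_notMem fun ω hω => ?_
        rw [Set.mem_ofPred_eq] at hω
        have h1 := RDIPE.abs_estimator_le_one (N₁ := N₁) (Nat.succ_pos _) hsρ hsσ ω
        have h2 := RDIPE.abs_cosine_le_one hsρ hsσ
        have h3 := abs_sub (RDIPE.estimator (ρ' n) (σ' n) ω) (RDIPE.cosine (ρ' n) (σ' n))
        linarith
      rw [hempty, RDIPE.prob]
      simpa using Real.exp_pos (-δ)
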